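/- Let $\mathcal{S}\subset S^4$ be a smoothly embedded closed surface (compact, without boundary, not necessarily connected) which is orientable, equipped with an orientation. Then its normal Euler number vanishes: $e(\mathcal{S})=0$. Here the normal Euler number $e(\mathcal{S})$ of a (not necessarily orientable) smoothly embedded closed surface $\mathcal{S}\subset S^4$ is the integer obtained by counting with signs the finitely many zeros of a smooth section $s$ of the normal bundle $\nu\mathcal{S}$ that is transverse to the zero section. The sign of a zero $p$ is $+1$ if, for a basis $(e_1,e_2)$ of $T_p\mathcal{S}$, the basis $(e_1,e_2,ds_p(e_1),ds_p(e_2))$ of $T_pS^4=T_p\mathcal{S}\oplus\nu_p\mathcal{S}$ is positive for the standard orientation of $S^4$, and $-1$ otherwise; it does not depend on the choice of $(e_1,e_2)$. Such sections exist, and the count does not depend on the section. -/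

import Mathlib

open scoped Manifold ContDiff

/-- Euclidean 5-space. -/
abbrev E5 : Type := EuclideanSpace ℝ (Fin 5)

/-- The unit sphere `S⁴ ⊆ ℝ⁵`, with Mathlib's smooth structure. -/
abbrev S4 : Type := Metric.sphere (0 : E5) 1

/-- An orientation of a smooth surface: a family of smooth charts covering the surface, all of
whose transition maps have positive Jacobian determinant. -/
structure SurfaceOrientation (M : Type*) [TopologicalSpace M]
    [ChartedSpace (EuclideanSpace ℝ (Fin 2)) M] where
  charts : Set (OpenPartialHomeomorph M (EuclideanSpace ℝ (Fin 2)))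
  smooth : charts ⊆ IsManifold.maximalAtlas (𝓡 2) ∞ M
  cover : ∀ p : M, ∃ c ∈ charts, p ∈ c.source
  det_pos : ∀ c ∈ charts, ∀ c' ∈ charts, ∀ x ∈ (c.symm.trans c').source,
    0 < (fderiv ℝ (c.symm.trans c') x).det

section NormalEulerNumber

variable {M : Type*} [TopologicalSpace M] [ChartedSpace (EuclideanSpace ℝ (Fin 2)) M]

/-- The derivative at `p` of a map from a surface to `ℝ⁵`. -/
noncomputable def ambientDeriv (g : M → E5) (p : M) : TangentSpace (𝓡 2) p →L[ℝ] E5 :=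
  mfderiv (𝓡 2) 𝓘(ℝ, E5) g p

/-- The normal space at `p` of a surface `f : M → S⁴`: the vectors of `ℝ⁵` which are tangent to
`S⁴` at `f p` (that is, orthogonal to the vector `f p`) and orthogonal to the tangent plane of
the surface. -/
noncomputable def normalSpace (f : M → S4) (p : M) : Submodule ℝ E5 :=
  (Submodule.span ℝ {(f p : E5)} ⊔ (ambientDeriv (fun q => (f q : E5)) p).range)ᗮ

/-- `s` is a smooth section of the normal bundle of the surface `f : M → S⁴`, transverse to the
zero section: at every zero `p`, the derivative of `s` maps `T_p M` onto the normal space. -/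
structure IsTransverseNormalSection (f : M → S4) (s : M → E5) : Prop where
  smooth : ContMDiff (𝓡 2) 𝓘(ℝ, E5) ∞ s
  normal : ∀ p, s p ∈ normalSpace f p
  transverse : ∀ p, s p = 0 → (ambientDeriv s p).range = normalSpace f p

/-- The sign of a zero `p` of a normal section `s`: for a basis `e₀, e₁` of `T_p M`, it is the
sign of the basis `df e₀, df e₁, ds e₀, ds e₁` of the tangent space of `S⁴` at `f p`, where `S⁴`
is oriented as the boundary of the unit ball (outward normal first). A change of the basis
`e₀, e₁` multiplies the determinant by the square of the determinant of the change, so the sign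
depends neither on the basis nor on a local orientation of the surface; we take the coordinate
basis of the preferred chart at `p`. -/
noncomputable def zeroSign (f : M → S4) (s : M → E5) (p : M) : ℤ :=
  let e : Fin 2 → TangentSpace (𝓡 2) p := fun i => EuclideanSpace.single i (1 : ℝ)
  let F : M → E5 := fun q => (f q : E5)
  let v : Fin 5 → E5 := ![F p, ambientDeriv F p (e 0), ambientDeriv F p (e 1),
    ambientDeriv s p (e 0), ambientDeriv s p (e 1)]
  (SignType.sign (Matrix.det (Matrix.of fun i j => v i j)) : ℤ)

/-- `n` is the normal Euler number `e(S)` of the surface `f : M → S⁴`, which may be orientable or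
not: transverse sections of the normal bundle exist, and each of them has finitely many zeros,
whose signs add up to `n`. There is at most one such `n`. -/
def IsNormalEulerNumber (f : M → S4) (n : ℤ) : Prop :=
  (∃ s : M → E5, IsTransverseNormalSection f s) ∧
    ∀ s : M → E5, IsTransverseNormalSection f s →
      {p | s p = 0}.Finite ∧ ∑ᶠ p ∈ {p | s p = 0}, zeroSign f s p = n

end NormalEulerNumber

open Set MeasureTheory Topology Filter

/-! Pushing the surface off itself along a small multiple of a transverse normal section `s` turns
the zeros of `s` into the intersections of the surface with its push-off, with matching signs up to
one global sign. Two closed oriented surfaces in four-space have intersection number zero, so the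
signed count of zeros vanishes.

To work in ℝ⁴, the sphere is projected stereographically from a point missed by the surface
(`exists_unit_notMem_range`). Let F and G be the resulting maps M → ℝ⁴ coming from f and from f +
εs. For small ε, F p = G q forces p = q and s p = 0; this is the injectivity of a thin tube around
the surface (`exists_pos_eq_of_orthogonal`). At such a point the Jacobian of Φ(p, q) = F p - G q has
the sign of the zero times a sign common to all zeros (`det_stereo`, `det_diffMap_rayStereo`).

The map Φ from the closed oriented manifold M × M to the noncompact ℝ⁴ has degree zero. This is
expressed by integrals (`sum_sign_det_diffMap_eq_zero`). Let ρ be a bump density near 0. By change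
of variables near each zero, the pull-back of ρ dx₀dx₁dx₂dx₃ along Φ has integral (sum of signs) ·
∫ρ (`sign_mul_setIntegral_eq`). With ρ = ∂₀η the form is d(η dx₁dx₂dx₃), so the same integral is
zero. Splitting the pull-back into terms that are 2-forms on each factor (`apply_mul_det_diffMap`)
reduces the vanishing to Stokes' theorem for d(a db) on M itself, hence to integration by parts in a
chart (`setIntegral_chartJac_eq_zero`). Positivity of the transition Jacobians enters only in
`setIntegral_chartJac_eq`.

The definition also asks for a transverse section to exist. A constant vector, projected
orthogonally to the normal spaces, is one as soon as the vector is generic, by Sard's theorem in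
equal dimensions (`exists_common_regular_value`). -/

theorem two_le_infty : (2 : WithTop ℕ∞) ≤ ∞ := by
  exact WithTop.coe_le_coe.2 (le_top : (2 : ℕ∞) ≤ ⊤)

theorem one_add_one_le_infty : (1 + 1 : WithTop ℕ∞) ≤ ∞ := by
  rw [one_add_one_eq_two]; exact two_le_infty

/-! ### Two-forms on the plane -/

/-- The model plane of the surfaces. -/
abbrev Plane : Type := EuclideanSpace ℝ (Fin 2)

/-- The `i`-th standard basis vector of the plane. -/
noncomputable def planeVec (i : Fin 2) : Plane := EuclideanSpace.single i (1 : ℝ)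

theorem plane_eq_sum (v : Plane) : v = v 0 • planeVec 0 + v 1 • planeVec 1 := by
  ext i; fin_cases i <;> simp [planeVec]

/-- The wedge product of two linear forms on the plane, evaluated on the standard basis. -/
noncomputable def wedge (α β : Plane →L[ℝ] ℝ) : ℝ :=
  α (planeVec 0) * β (planeVec 1) - α (planeVec 1) * β (planeVec 0)

theorem det_plane (A : Plane →L[ℝ] Plane) :
    A.det = A (planeVec 0) 0 * A (planeVec 1) 1 - A (planeVec 1) 0 * A (planeVec 0) 1 := by
  have h := LinearMap.det_toMatrix (EuclideanSpace.basisFun (Fin 2) ℝ).toBasis (A : Plane →ₗ[ℝ] Plane)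
  rw [Matrix.det_fin_two] at h
  simp only [LinearMap.toMatrix_apply] at h
  simp at h
  rw [ContinuousLinearMap.det, ← h]
  simp [planeVec]

/-- Pull-back scales a top-degree form by the determinant; this makes `chartJac` transform by the
Jacobian of a change of chart. -/
theorem wedge_comp (α β : Plane →L[ℝ] ℝ) (A : Plane →L[ℝ] Plane) :
    wedge (α.comp A) (β.comp A) = A.det * wedge α β := by
  have h : ∀ (γ : Plane →L[ℝ] ℝ) (i : Fin 2), γ (A (planeVec i))
      = A (planeVec i) 0 * γ (planeVec 0) + A (planeVec i) 1 * γ (planeVec 1) := by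
    intro γ i
    conv_lhs => rw [plane_eq_sum (A (planeVec i))]
    simp
  rw [det_plane]
  simp only [wedge, ContinuousLinearMap.comp_apply, h]
  ring

/-- Chart targets may have infinite measure and the integrands may be unbounded near their boundary,
so integrability always comes from a compact support inside the target. -/
theorem integrableOn_of_continuousOn_of_eq_zero {E : Type*} [NormedAddCommGroup E]
    [MeasurableSpace E] [BorelSpace E] {μ : Measure E} [IsFiniteMeasureOnCompacts μ]
    {U K : Set E} {φ : E → ℝ} (hU : MeasurableSet U) (hK : IsCompact K) (hKU : K ⊆ U)
    (hφ : ContinuousOn φ U) (h0 : ∀ z ∈ U, z ∉ K → φ z = 0) : IntegrableOn φ U μ := by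
  have h1 : IntegrableOn φ K μ := (hφ.mono hKU).integrableOn_compact hK
  exact h1.of_forall_sdiff_eq_zero hU fun z hz => h0 z hz.1 hz.2

/-! ### Jacobians in charts, change of charts, integration by parts -/

section ChartSupport

variable {M : Type*} [TopologicalSpace M]

theorem isCompact_chart_image_tsupport [CompactSpace M] {c : OpenPartialHomeomorph M Plane}
    {a : M → ℝ} (hs : tsupport a ⊆ c.source) : IsCompact (c '' tsupport a) :=
  (isClosed_tsupport a).isCompact.image_of_continuousOn (c.continuousOn.mono hs)

theorem chart_image_tsupport_subset {c : OpenPartialHomeomorph M Plane}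
    {a : M → ℝ} (hs : tsupport a ⊆ c.source) : c '' tsupport a ⊆ c.target := by
  rintro _ ⟨p, hp, rfl⟩; exact c.map_source (hs hp)

theorem notMem_tsupport_of_notMem_image {c : OpenPartialHomeomorph M Plane}
    {a : M → ℝ} {z : Plane} (hz : z ∈ c.target) (h : z ∉ c '' tsupport a) :
    c.symm z ∉ tsupport a := fun h' => h ⟨_, h', c.right_inv hz⟩

theorem eventually_comp_chart_symm_eq_zero {c : OpenPartialHomeomorph M Plane} {a : M → ℝ}
    {z : Plane} (hz : z ∈ c.target) (h : c.symm z ∉ tsupport a) : a ∘ c.symm =ᶠ[𝓝 z] 0 := by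
  have := c.symm.continuousAt (x := z) hz
  filter_upwards [this.eventually ((isClosed_tsupport a).isOpen_compl.mem_nhds h)] with w hw
  exact image_eq_zero_of_notMem_tsupport (f := a) hw

/-- The Jacobian determinant of a pair of functions in a chart. -/
noncomputable def chartJac (c : OpenPartialHomeomorph M Plane) (a b : M → ℝ) (z : Plane) : ℝ :=
  wedge (fderiv ℝ (a ∘ c.symm) z) (fderiv ℝ (b ∘ c.symm) z)

theorem chartJac_eq_zero_of_notMem_tsupport {c : OpenPartialHomeomorph M Plane} {a : M → ℝ}
    (b : M → ℝ) {z : Plane} (hz : z ∈ c.target) (h : c.symm z ∉ tsupport a) :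
    chartJac c a b z = 0 := by
  have : fderiv ℝ (a ∘ c.symm) z = 0 := by
    rw [(eventually_comp_chart_symm_eq_zero hz h).fderiv_eq]; exact fderiv_const_apply 0
  simp [chartJac, wedge, this]

end ChartSupport

section Chart

variable {M : Type*} [TopologicalSpace M] [ChartedSpace Plane M]

theorem contDiffOn_comp_chart_symm {E : Type*} [NormedAddCommGroup E] [NormedSpace ℝ E]
    {c : OpenPartialHomeomorph M Plane} (hc : c ∈ IsManifold.maximalAtlas (𝓡 2) ∞ M)
    {a : M → E} (ha : ContMDiff (𝓡 2) 𝓘(ℝ, E) ∞ a) :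
    ContDiffOn ℝ ∞ (a ∘ c.symm) c.target :=
  (ha.comp_contMDiffOn (contMDiffOn_symm_of_mem_maximalAtlas hc)).contDiffOn

theorem contDiffAt_comp_chart_symm {E : Type*} [NormedAddCommGroup E] [NormedSpace ℝ E]
    {c : OpenPartialHomeomorph M Plane} (hc : c ∈ IsManifold.maximalAtlas (𝓡 2) ∞ M)
    {a : M → E} (ha : ContMDiff (𝓡 2) 𝓘(ℝ, E) ∞ a) {z : Plane} (hz : z ∈ c.target) :
    ContDiffAt ℝ ∞ (a ∘ c.symm) z :=
  (contDiffOn_comp_chart_symm hc ha).contDiffAt (c.open_target.mem_nhds hz)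

theorem continuousOn_fderiv_comp_chart_symm {E : Type*} [NormedAddCommGroup E] [NormedSpace ℝ E]
    {c : OpenPartialHomeomorph M Plane} (hc : c ∈ IsManifold.maximalAtlas (𝓡 2) ∞ M)
    {a : M → E} (ha : ContMDiff (𝓡 2) 𝓘(ℝ, E) ∞ a) :
    ContinuousOn (fderiv ℝ (a ∘ c.symm)) c.target :=
  (contDiffOn_comp_chart_symm hc ha).continuousOn_fderiv_of_isOpen c.open_target (by simp)

theorem ContinuousOn.wedge {X : Type*} [TopologicalSpace X] {s : Set X}
    {α β : X → Plane →L[ℝ] ℝ} (hα : ContinuousOn α s) (hβ : ContinuousOn β s) :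
    ContinuousOn (fun x => wedge (α x) (β x)) s := by
  unfold _root_.wedge
  exact ((hα.clm_apply continuousOn_const).mul (hβ.clm_apply continuousOn_const)).sub
    ((hα.clm_apply continuousOn_const).mul (hβ.clm_apply continuousOn_const))

theorem continuousOn_chartJac
    {c : OpenPartialHomeomorph M Plane} (hc : c ∈ IsManifold.maximalAtlas (𝓡 2) ∞ M)
    {a b : M → ℝ} (ha : ContMDiff (𝓡 2) 𝓘(ℝ, ℝ) ∞ a) (hb : ContMDiff (𝓡 2) 𝓘(ℝ, ℝ) ∞ b) :
    ContinuousOn (chartJac c a b) c.target :=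
  (continuousOn_fderiv_comp_chart_symm hc ha).wedge (continuousOn_fderiv_comp_chart_symm hc hb)

theorem chartJac_trans [IsManifold (𝓡 2) ∞ M] {c c' : OpenPartialHomeomorph M Plane}
    (hc : c ∈ IsManifold.maximalAtlas (𝓡 2) ∞ M) (hc' : c' ∈ IsManifold.maximalAtlas (𝓡 2) ∞ M)
    {a b : M → ℝ} (ha : ContMDiff (𝓡 2) 𝓘(ℝ, ℝ) ∞ a) (hb : ContMDiff (𝓡 2) 𝓘(ℝ, ℝ) ∞ b)
    {z : Plane} (hz : z ∈ (c.symm.trans c').source) :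
    DifferentiableAt ℝ (c.symm.trans c') z ∧ chartJac c a b z =
      (fderiv ℝ (c.symm.trans c') z).det * chartJac c' a b (c.symm.trans c' z) := by
  have hz1 : z ∈ c.target := hz.1
  have hz2 : c.symm z ∈ c'.source := hz.2
  have hd : DifferentiableAt ℝ (c.symm.trans c') z := by
    have h1 : ContMDiffAt (𝓡 2) (𝓡 2) ∞ (c' ∘ c.symm) z :=
      (contMDiffAt_of_mem_maximalAtlas hc' hz2).comp z
        (contMDiffAt_symm_of_mem_maximalAtlas hc hz1)
    exact (contMDiffAt_iff_contDiffAt.1 h1).differentiableAt (by simp)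
  refine ⟨hd, ?_⟩
  have key : ∀ {a : M → ℝ}, ContMDiff (𝓡 2) 𝓘(ℝ, ℝ) ∞ a → fderiv ℝ (a ∘ c.symm) z =
      (fderiv ℝ (a ∘ c'.symm) (c.symm.trans c' z)).comp (fderiv ℝ (c.symm.trans c') z) := by
    intro a ha
    have h1 : a ∘ c.symm =ᶠ[𝓝 z] (a ∘ c'.symm) ∘ (c.symm.trans c') := by
      filter_upwards [(c.symm.trans c').open_source.mem_nhds hz] with w hw
      have : c.symm w ∈ c'.source := hw.2
      simp [c'.left_inv this]
    rw [h1.fderiv_eq]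
    have h2 : (c.symm.trans c') z ∈ c'.target := c'.map_source hz2
    exact fderiv_comp z ((contDiffAt_comp_chart_symm hc' ha h2).differentiableAt (by simp)) hd
  simp only [chartJac]
  rw [key ha, key hb, wedge_comp]

/-- Both integrals live on the overlap of the charts, where change of variables applies. The
orientation makes the Jacobian equal to its absolute value. -/
theorem setIntegral_chartJac_eq [IsManifold (𝓡 2) ∞ M] (o : SurfaceOrientation M)
    {c c' : OpenPartialHomeomorph M Plane} (hc : c ∈ o.charts) (hc' : c' ∈ o.charts)
    {h a b : M → ℝ} (ha : ContMDiff (𝓡 2) 𝓘(ℝ, ℝ) ∞ a) (hb : ContMDiff (𝓡 2) 𝓘(ℝ, ℝ) ∞ b)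
    (h1 : ∀ z ∈ c.target, c.symm z ∉ c'.source → h (c.symm z) * chartJac c a b z = 0)
    (h2 : ∀ z ∈ c'.target, c'.symm z ∉ c.source → h (c'.symm z) * chartJac c' a b z = 0) :
    ∫ z in c.target, h (c.symm z) * chartJac c a b z =
      ∫ z in c'.target, h (c'.symm z) * chartJac c' a b z := by
  set τ := c.symm.trans c' with hτ
  have e1 : ∫ z in c.target, h (c.symm z) * chartJac c a b z =
      ∫ z in τ.source, h (c.symm z) * chartJac c a b z :=
    setIntegral_eq_of_subset_of_forall_sdiff_eq_zero c.open_target.measurableSet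
      (fun z hz => hz.1) fun z hz => h1 z hz.1 fun h' => hz.2 ⟨hz.1, h'⟩
  have e2 : ∫ z in c'.target, h (c'.symm z) * chartJac c' a b z =
      ∫ z in τ.target, h (c'.symm z) * chartJac c' a b z :=
    setIntegral_eq_of_subset_of_forall_sdiff_eq_zero c'.open_target.measurableSet
      (fun z hz => hz.1) fun z hz => h2 z hz.1 fun h' => hz.2 ⟨hz.1, h'⟩
  rw [e1, e2, ← τ.image_source_eq_target]
  rw [integral_image_eq_integral_abs_det_fderiv_smul volume τ.open_source.measurableSet
    (f' := fun z => fderiv ℝ τ z) (fun z hz => ((chartJac_trans (o.smooth hc) (o.smooth hc')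
      ha hb hz).1.hasFDerivAt).hasFDerivWithinAt) τ.injOn]
  refine setIntegral_congr_fun τ.open_source.measurableSet fun z hz => ?_
  have hd := (chartJac_trans (o.smooth hc) (o.smooth hc') ha hb hz).2
  have hz2 : c.symm z ∈ c'.source := hz.2
  have hinv : c'.symm (τ z) = c.symm z := by simp [hτ, c'.left_inv hz2]
  simp only [smul_eq_mul]
  rw [abs_of_pos (o.det_pos c hc c' hc' z hz), hinv, hd]
  ring

/-- Integrating ∂₀a ∂₁b - ∂₁a ∂₀b by parts moves the derivatives from a to b and leaves a times the
difference of the mixed second derivatives of b. -/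
theorem setIntegral_chartJac_eq_zero [CompactSpace M] [T2Space M]
    {c : OpenPartialHomeomorph M Plane} (hc : c ∈ IsManifold.maximalAtlas (𝓡 2) ∞ M)
    {a b : M → ℝ} (ha : ContMDiff (𝓡 2) 𝓘(ℝ, ℝ) ∞ a) (hb : ContMDiff (𝓡 2) 𝓘(ℝ, ℝ) ∞ b)
    (hs : tsupport a ⊆ c.source) : ∫ z in c.target, chartJac c a b z = 0 := by
  have hK := isCompact_chart_image_tsupport hs
  have hKt := chart_image_tsupport_subset hs
  set K := c '' tsupport a with hKdef
  -- Only a can be extended by zero to a smooth function on the whole plane; b is controlled on the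
  -- target alone. Hence integration by parts uses differentiability of `g i` only on the support of
  -- `A`.
  set A : Plane → ℝ := c.target.indicator (a ∘ c.symm) with hA
  set g : Fin 2 → Plane → ℝ := fun i z => fderiv ℝ (b ∘ c.symm) z (planeVec i) with hg
  have hAeq : ∀ z ∈ c.target, A =ᶠ[𝓝 z] a ∘ c.symm := fun z hz => by
    filter_upwards [c.open_target.mem_nhds hz] with w hw
    exact indicator_of_mem hw _
  have hA0' : ∀ z ∉ K, A z = 0 := fun z hz => by
    by_cases hzt : z ∈ c.target
    · rw [hA, indicator_of_mem hzt]
      exact image_eq_zero_of_notMem_tsupport (f := a) (notMem_tsupport_of_notMem_image hzt hz)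
    · exact indicator_of_notMem hzt _
  have hA0 : ∀ z ∉ K, A =ᶠ[𝓝 z] 0 := fun z hz => by
    filter_upwards [hK.isClosed.isOpen_compl.mem_nhds hz] with w hw using hA0' w hw
  have hAd : ContDiff ℝ ∞ A := by
    rw [contDiff_iff_contDiffAt]
    intro z
    by_cases hz : z ∈ K
    · exact (contDiffAt_comp_chart_symm hc ha (hKt hz)).congr_of_eventuallyEq (hAeq z (hKt hz))
    · exact contDiffAt_const.congr_of_eventuallyEq (hA0 z hz)
  have hA' : ∀ z ∉ K, fderiv ℝ A z = 0 := fun z hz => by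
    rw [(hA0 z hz).fderiv_eq]; exact fderiv_const_apply 0
  have hts : tsupport A ⊆ K := by
    refine closure_minimal (fun z hz => ?_) hK.isClosed
    by_contra h; exact hz (hA0' z h)
  have hAc := hAd.continuous
  have hAc' : Continuous (fderiv ℝ A) := hAd.continuous_fderiv (by simp)
  have hgd : ∀ i, ContDiffOn ℝ 1 (g i) c.target := fun i =>
    ((contDiffOn_comp_chart_symm hc hb).fderiv_of_isOpen c.open_target (m := 1)
      one_add_one_le_infty).clm_apply contDiffOn_const
  have hgc : ∀ i, ContinuousOn (g i) c.target := fun i => (hgd i).continuousOn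
  have hgc' : ∀ i, ContinuousOn (fderiv ℝ (g i)) c.target := fun i =>
    (hgd i).continuousOn_fderiv_of_isOpen c.open_target (by simp)
  have hint : ∀ φ : Plane → ℝ, ContinuousOn φ c.target → (∀ z ∉ K, φ z = 0) → Integrable φ := by
    intro φ h1 h2
    have h3 : IntegrableOn φ K := (h1.mono hKt).integrableOn_compact hK
    exact (integrableOn_iff_integrable_of_support_subset fun z hz => by
      by_contra h; exact hz (h2 z h)).1 h3
  have parts : ∀ i j, Integrable (fun z => A z * fderiv ℝ (g i) z (planeVec j)) ∧
      Integrable (fun z => fderiv ℝ A z (planeVec j) * g i z) ∧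
      ∫ z, A z * fderiv ℝ (g i) z (planeVec j) = - ∫ z, fderiv ℝ A z (planeVec j) * g i z := by
    intro i j
    have i1 : Integrable (fun z => fderiv ℝ A z (planeVec j) * g i z) :=
      hint _ ((hAc'.clm_apply continuous_const).continuousOn.mul (hgc i))
        fun z hz => by simp [hA' z hz]
    have i2 : Integrable (fun z => A z * fderiv ℝ (g i) z (planeVec j)) :=
      hint _ (hAc.continuousOn.mul ((hgc' i).clm_apply continuousOn_const))
        fun z hz => by simp [hA0' z hz]
    refine ⟨i2, i1, integral_mul_fderiv_eq_neg_fderiv_mul_of_integrable i1 i2 ?_ ?_ ?_⟩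
    · exact hint _ (hAc.continuousOn.mul (hgc i)) fun z hz => by simp [hA0' z hz]
    · exact fun z _ => hAd.differentiable (by simp) z
    · exact fun z hz => ((hgd i).contDiffAt
        (c.open_target.mem_nhds (hKt (hts hz)))).differentiableAt (by simp)
  have hJ : ∫ z in c.target, chartJac c a b z =
      ∫ z, (fderiv ℝ A z (planeVec 0) * g 1 z - fderiv ℝ A z (planeVec 1) * g 0 z) := by
    rw [← setIntegral_eq_integral_of_forall_compl_eq_zero (s := c.target) (f := fun z =>
      fderiv ℝ A z (planeVec 0) * g 1 z - fderiv ℝ A z (planeVec 1) * g 0 z)]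
    · refine setIntegral_congr_fun c.open_target.measurableSet fun z hz => ?_
      simp only [chartJac, wedge, (hAeq z hz).fderiv_eq, hg]
    · intro z hz
      simp [hA' z fun h => hz (hKt h)]
  rw [hJ, integral_sub (parts 1 0).2.1 (parts 0 1).2.1]
  have hsymm : ∫ z, A z * fderiv ℝ (g 1) z (planeVec 0) =
      ∫ z, A z * fderiv ℝ (g 0) z (planeVec 1) := by
    congr 1
    ext z
    by_cases hz : z ∈ K
    · have hb2 := contDiffAt_comp_chart_symm hc hb (hKt hz)
      have hs := hb2.isSymmSndFDerivAt (by simpa using two_le_infty)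
      have hdd : DifferentiableAt ℝ (fderiv ℝ (b ∘ c.symm)) z :=
        (hb2.fderiv_right (m := 1) one_add_one_le_infty).differentiableAt (by simp)
      have hv : ∀ i j, fderiv ℝ (g i) z (planeVec j) =
          fderiv ℝ (fderiv ℝ (b ∘ c.symm)) z (planeVec j) (planeVec i) := by
        intro i j
        simp only [hg]
        rw [fderiv_clm_apply hdd (differentiableAt_const _)]
        simp
      rw [hv, hv, hs.eq]
    · simp [hA0' z hz]
  have p1 := (parts 1 0).2.2
  have p2 := (parts 0 1).2.2
  linarith

end Chart

/-! ### Stokes' theorem on a closed oriented surface -/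

section Stokes

variable {M : Type*} [TopologicalSpace M] [ChartedSpace Plane M]

/-- A finite smooth partition of unity subordinate to positively oriented charts. -/
structure ChartPartition (o : SurfaceOrientation M) (t : Finset M) where
  chart : M → OpenPartialHomeomorph M Plane
  weight : M → M → ℝ
  chart_mem : ∀ x, chart x ∈ o.charts
  smooth : ∀ x, ContMDiff (𝓡 2) 𝓘(ℝ, ℝ) ∞ (weight x)
  tsupport_subset : ∀ x, tsupport (weight x) ⊆ (chart x).source
  sum_eq_one : ∀ p, ∑ x ∈ t, weight x p = 1

/-- The open sets `U x`, smaller than the chart domains, make it possible to keep the weight indexed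
by one zero away from all the other zeros. -/
theorem exists_chartPartition [CompactSpace M] [T2Space M] [IsManifold (𝓡 2) ∞ M]
    (o : SurfaceOrientation M) (c : M → OpenPartialHomeomorph M Plane)
    (hc : ∀ x, c x ∈ o.charts) (U : M → Set M) (hU : ∀ x, IsOpen (U x)) (hxU : ∀ x, x ∈ U x)
    (hUc : ∀ x, U x ⊆ (c x).source) :
    ∃ (t : Finset M) (P : ChartPartition o t), P.chart = c ∧
      ∀ x, tsupport (P.weight x) ⊆ U x := by
  obtain ⟨f, hf⟩ := SmoothPartitionOfUnity.exists_isSubordinate (𝓡 2) (isClosed_univ (X := M)) U hU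
    (fun x _ => mem_iUnion.2 ⟨x, hxU x⟩)
  have hfin := f.locallyFinite.finite_nonempty_of_compact
  refine ⟨hfin.toFinset, ⟨c, fun x => f x, hc, fun x => (f x).contMDiff,
    fun x => (hf x).trans (hUc x), fun p => ?_⟩, rfl, hf⟩
  rw [← f.sum_eq_one (mem_univ p)]
  refine (finsum_eq_sum_of_support_subset _ fun x hx => ?_).symm
  simp only [Finite.coe_toFinset, mem_ofPred_eq]
  exact ⟨p, hx⟩

variable [CompactSpace M] {o : SurfaceOrientation M} {t : Finset M}

theorem ChartPartition.integrableOn_weight_mul (P : ChartPartition o t) (x : M) {g : Plane → ℝ}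
    (hg : ContinuousOn g (P.chart x).target) :
    IntegrableOn (fun z => P.weight x ((P.chart x).symm z) * g z) (P.chart x).target :=
  integrableOn_of_continuousOn_of_eq_zero (P.chart x).open_target.measurableSet
    (isCompact_chart_image_tsupport (P.tsupport_subset x))
    (chart_image_tsupport_subset (P.tsupport_subset x))
    (((P.smooth x).continuous.comp_continuousOn (P.chart x).continuousOn_symm).mul hg)
    fun z hz h => by
      rw [image_eq_zero_of_notMem_tsupport (notMem_tsupport_of_notMem_image hz h), zero_mul]

/-- Stokes' theorem for the exact form `d(a db)` on a closed oriented surface. -/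
theorem ChartPartition.sum_setIntegral_chartJac_eq_zero [T2Space M] [IsManifold (𝓡 2) ∞ M]
    (P : ChartPartition o t) {a b : M → ℝ} (ha : ContMDiff (𝓡 2) 𝓘(ℝ, ℝ) ∞ a)
    (hb : ContMDiff (𝓡 2) 𝓘(ℝ, ℝ) ∞ b) :
    ∑ x ∈ t, ∫ z in (P.chart x).target,
      P.weight x ((P.chart x).symm z) * chartJac (P.chart x) a b z = 0 := by
  have hm : ∀ x, P.chart x ∈ IsManifold.maximalAtlas (𝓡 2) ∞ M :=
    fun x => o.smooth (P.chart_mem x)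
  -- The partition of unity is used twice: cutting a into pieces `A y` supported in single charts,
  -- and inside the global integral.
  set A : M → M → ℝ := fun y p => P.weight y p * a p with hA
  have hAs : ∀ y, ContMDiff (𝓡 2) 𝓘(ℝ, ℝ) ∞ (A y) := fun y => (P.smooth y).mul ha
  have hAt : ∀ y, tsupport (A y) ⊆ tsupport (P.weight y) := fun y => tsupport_mul_subset_left
  have hsum : a = fun p => ∑ y ∈ t, A y p := by
    ext p; simp only [hA, ← Finset.sum_mul, P.sum_eq_one, one_mul]
  have hsplit : ∀ x, ∀ z ∈ (P.chart x).target,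
      chartJac (P.chart x) a b z = ∑ y ∈ t, chartJac (P.chart x) (A y) b z := by
    intro x z hz
    have h1 : a ∘ (P.chart x).symm = fun w => ∑ y ∈ t, (A y ∘ (P.chart x).symm) w := by
      conv_lhs => rw [hsum]
      rfl
    have h2 : fderiv ℝ (a ∘ (P.chart x).symm) z
        = ∑ y ∈ t, fderiv ℝ (A y ∘ (P.chart x).symm) z := by
      rw [h1]
      exact fderiv_fun_sum fun y _ =>
        (contDiffAt_comp_chart_symm (hm x) (hAs y) hz).differentiableAt (by simp)
    simp only [chartJac, wedge, h2, sum_apply, Finset.sum_mul,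
      Finset.sum_sub_distrib]
  -- The piece `A y` is moved from chart x to chart y, which contains its support. After exchanging
  -- the sums, the weights indexed by x add up to 1 and the integral in chart y vanishes.
  have hstep : ∀ x, ∫ z in (P.chart x).target,
      P.weight x ((P.chart x).symm z) * chartJac (P.chart x) a b z =
      ∑ y ∈ t, ∫ z in (P.chart y).target,
        P.weight x ((P.chart y).symm z) * chartJac (P.chart y) (A y) b z := by
    intro x
    rw [setIntegral_congr_fun (P.chart x).open_target.measurableSet
      (g := fun z => ∑ y ∈ t, P.weight x ((P.chart x).symm z) * chartJac (P.chart x) (A y) b z)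
      (fun z hz => by simp only [hsplit x z hz, Finset.mul_sum])]
    rw [integral_finsetSum _ fun y _ =>
      P.integrableOn_weight_mul x (continuousOn_chartJac (hm x) (hAs y) hb)]
    refine Finset.sum_congr rfl fun y _ => ?_
    refine setIntegral_chartJac_eq o (P.chart_mem x) (P.chart_mem y) (hAs y) hb ?_ ?_
    · intro z hz h
      rw [chartJac_eq_zero_of_notMem_tsupport b hz fun h' =>
        h (P.tsupport_subset y (hAt y h')), mul_zero]
    · intro z hz h
      rw [image_eq_zero_of_notMem_tsupport fun h' => h (P.tsupport_subset x h'), zero_mul]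
  simp only [hstep]
  rw [Finset.sum_comm]
  refine Finset.sum_eq_zero fun y _ => ?_
  have hcomp := isCompact_chart_image_tsupport ((hAt y).trans (P.tsupport_subset y))
  rw [← integral_finsetSum]
  · rw [← setIntegral_chartJac_eq_zero (hm y) (hAs y) hb ((hAt y).trans (P.tsupport_subset y))]
    refine setIntegral_congr_fun (P.chart y).open_target.measurableSet fun z _ => ?_
    simp only [← Finset.sum_mul, P.sum_eq_one, one_mul]
  · intro x _
    refine integrableOn_of_continuousOn_of_eq_zero (P.chart y).open_target.measurableSet hcomp
      (chart_image_tsupport_subset ((hAt y).trans (P.tsupport_subset y)))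
      (((P.smooth x).continuous.comp_continuousOn (P.chart y).continuousOn_symm).mul
        (continuousOn_chartJac (hm y) (hAs y) hb)) fun z hz h => ?_
    rw [chartJac_eq_zero_of_notMem_tsupport b hz (notMem_tsupport_of_notMem_image hz h), mul_zero]

end Stokes

/-! ### Linear algebra of the difference map on a product of two planes -/

/-- Four-space, as the product of two planes. -/
abbrev FourSpace : Type := Plane × Plane

/-- The coordinate functions of four-space. -/
noncomputable def coord : Fin 4 → FourSpace →L[ℝ] ℝ :=
  ![(EuclideanSpace.proj 0).comp (ContinuousLinearMap.fst ℝ Plane Plane),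
    (EuclideanSpace.proj 1).comp (ContinuousLinearMap.fst ℝ Plane Plane),
    (EuclideanSpace.proj 0).comp (ContinuousLinearMap.snd ℝ Plane Plane),
    (EuclideanSpace.proj 1).comp (ContinuousLinearMap.snd ℝ Plane Plane)]

/-- The standard basis vectors of four-space. -/
noncomputable def fourVec : Fin 4 → FourSpace :=
  ![(planeVec 0, 0), (planeVec 1, 0), (0, planeVec 0), (0, planeVec 1)]

theorem apply_eq_sum_coord (l : FourSpace →L[ℝ] ℝ) (v : FourSpace) :
    l v = l (fourVec 0) * coord 0 v + l (fourVec 1) * coord 1 v + l (fourVec 2) * coord 2 v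
      + l (fourVec 3) * coord 3 v := by
  have h : v = coord 0 v • fourVec 0 + coord 1 v • fourVec 1 + coord 2 v • fourVec 2
      + coord 3 v • fourVec 3 := by
    refine Prod.ext ?_ ?_
    · simpa [coord, fourVec] using plane_eq_sum v.1
    · simpa [coord, fourVec] using plane_eq_sum v.2
  conv_lhs => rw [h]
  simp only [map_add, map_smul, smul_eq_mul]
  ring

/-- The derivative of `(z, w) ↦ F z - G w` in terms of the derivatives of `F` and `G`. -/
noncomputable def diffMap (F' G' : Plane →L[ℝ] FourSpace) : FourSpace →L[ℝ] FourSpace :=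
  F'.comp (ContinuousLinearMap.fst ℝ Plane Plane) -
    G'.comp (ContinuousLinearMap.snd ℝ Plane Plane)

theorem det_diffMap_eq_matrix_det (F' G' : Plane →L[ℝ] FourSpace) :
    (diffMap F' G').det = Matrix.det (Matrix.of fun i j : Fin 4 =>
      coord i ((![F' (planeVec 0), F' (planeVec 1), -G' (planeVec 0), -G' (planeVec 1)] :
        Fin 4 → FourSpace) j)) := by
  set e := (EuclideanSpace.basisFun (Fin 2) ℝ).toBasis
  have h := LinearMap.det_toMatrix ((e.prod e).reindex finSumFinEquiv)
    (diffMap F' G' : FourSpace →ₗ[ℝ] FourSpace)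
  rw [ContinuousLinearMap.det, ← h]
  congr 1
  have h0 : (finSumFinEquiv (m := 2) (n := 2)).symm 0 = Sum.inl 0 := by decide
  have h1 : (finSumFinEquiv (m := 2) (n := 2)).symm 1 = Sum.inl 1 := by decide
  have h2 : (finSumFinEquiv (m := 2) (n := 2)).symm 2 = Sum.inr 0 := by decide
  have h3 : (finSumFinEquiv (m := 2) (n := 2)).symm 3 = Sum.inr 1 := by decide
  ext i j
  rw [LinearMap.toMatrix_apply]
  fin_cases i <;> fin_cases j <;>
    simp [h0, h1, h2, h3, diffMap, e, coord, planeVec, Module.Basis.prod_apply]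

/-- The two-by-two minors of a linear map from the plane to four-space. -/
noncomputable def minor (F' : Plane →L[ℝ] FourSpace) (i j : Fin 4) : ℝ :=
  wedge ((coord i).comp F') ((coord j).comp F')

/-- This is l ∧ dx₁ ∧ dx₂ ∧ dx₃ = l(e₀) dx₀ ∧ dx₁ ∧ dx₂ ∧ dx₃ pulled back to the product: exactly
two of the four factors must be evaluated on each plane, which gives six terms. The minus sign in
front of G' enters twice in each term and cancels. -/
theorem apply_mul_det_diffMap (l : FourSpace →L[ℝ] ℝ) (F' G' : Plane →L[ℝ] FourSpace) :
    l (fourVec 0) * (diffMap F' G').det =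
      wedge (l.comp F') ((coord 1).comp F') * minor G' 2 3
      - wedge (l.comp F') ((coord 2).comp F') * minor G' 1 3
      + wedge (l.comp F') ((coord 3).comp F') * minor G' 1 2
      + minor F' 1 2 * wedge (l.comp G') ((coord 3).comp G')
      - minor F' 1 3 * wedge (l.comp G') ((coord 2).comp G')
      + minor F' 2 3 * wedge (l.comp G') ((coord 1).comp G') := by
  rw [det_diffMap_eq_matrix_det, Matrix.det_succ_row_zero]
  simp only [minor, wedge, ContinuousLinearMap.comp_apply]
  rw [apply_eq_sum_coord l (F' (planeVec 0)), apply_eq_sum_coord l (F' (planeVec 1)),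
    apply_eq_sum_coord l (G' (planeVec 0)), apply_eq_sum_coord l (G' (planeVec 1))]
  simp only [Fin.sum_univ_four, Matrix.det_fin_three, Matrix.submatrix_apply, Matrix.of_apply]
  simp [Fin.succAbove, Fin.lt_def]
  ring

/-! ### The pulled-back exact form has integral zero -/

section DegreeIntegral

variable {M : Type*} [TopologicalSpace M] [ChartedSpace Plane M]
  {o : SurfaceOrientation M} {t : Finset M}

theorem ChartPartition.integrableOn_weight_mul_weight_mul [CompactSpace M] (P : ChartPartition o t) (x y : M)
    {g : FourSpace → ℝ} (hg : ContinuousOn g ((P.chart x).target ×ˢ (P.chart y).target)) :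
    IntegrableOn (fun v : FourSpace => P.weight x ((P.chart x).symm v.1) *
      P.weight y ((P.chart y).symm v.2) * g v) ((P.chart x).target ×ˢ (P.chart y).target) := by
  refine integrableOn_of_continuousOn_of_eq_zero
    ((P.chart x).open_target.prod (P.chart y).open_target).measurableSet
    ((isCompact_chart_image_tsupport (P.tsupport_subset x)).prod
      (isCompact_chart_image_tsupport (P.tsupport_subset y)))
    (prod_mono (chart_image_tsupport_subset (P.tsupport_subset x))
      (chart_image_tsupport_subset (P.tsupport_subset y))) ?_ ?_
  · refine ContinuousOn.mul (ContinuousOn.mul ?_ ?_) hg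
    · exact ((P.smooth x).continuous.comp_continuousOn (P.chart x).continuousOn_symm).comp
        continuousOn_fst fun v hv => hv.1
    · exact ((P.smooth y).continuous.comp_continuousOn (P.chart y).continuousOn_symm).comp
        continuousOn_snd fun v hv => hv.2
  · intro v hv h
    rw [mem_prod, not_and_or] at h
    rcases h with h | h
    · rw [image_eq_zero_of_notMem_tsupport (notMem_tsupport_of_notMem_image hv.1 h)]; simp
    · rw [image_eq_zero_of_notMem_tsupport (f := P.weight y)
        (notMem_tsupport_of_notMem_image hv.2 h)]; simp

theorem ChartPartition.sum_setIntegral_prod_eq_zero_of_right (P : ChartPartition o t)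
    {φ : M → M → FourSpace → ℝ}
    (hi : ∀ x y, IntegrableOn (φ x y) ((P.chart x).target ×ˢ (P.chart y).target))
    (h : ∀ x, ∀ z ∈ (P.chart x).target,
      ∑ y ∈ t, ∫ w in (P.chart y).target, φ x y (z, w) = 0) :
    ∑ x ∈ t, ∑ y ∈ t, ∫ v in (P.chart x).target ×ˢ (P.chart y).target, φ x y v = 0 := by
  refine Finset.sum_eq_zero fun x _ => ?_
  have h1 : ∀ y ∈ t, ∫ v in (P.chart x).target ×ˢ (P.chart y).target, φ x y v =
      ∫ z in (P.chart x).target, ∫ w in (P.chart y).target, φ x y (z, w) :=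
    fun y _ => setIntegral_prod _ (hi x y)
  rw [Finset.sum_congr rfl h1, ← integral_finsetSum]
  · rw [setIntegral_congr_fun (P.chart x).open_target.measurableSet (h x)]
    simp
  · intro y _
    have := hi x y
    rw [IntegrableOn, Measure.volume_eq_prod, ← Measure.prod_restrict] at this
    exact this.integral_prod_left

theorem ChartPartition.sum_setIntegral_prod_eq_zero_of_left (P : ChartPartition o t)
    {φ : M → M → FourSpace → ℝ}
    (hi : ∀ x y, IntegrableOn (φ x y) ((P.chart x).target ×ˢ (P.chart y).target))
    (h : ∀ y, ∀ w ∈ (P.chart y).target,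
      ∑ x ∈ t, ∫ z in (P.chart x).target, φ x y (z, w) = 0) :
    ∑ x ∈ t, ∑ y ∈ t, ∫ v in (P.chart x).target ×ˢ (P.chart y).target, φ x y v = 0 := by
  rw [Finset.sum_comm]
  have h1 := P.sum_setIntegral_prod_eq_zero_of_right (φ := fun y x v => φ x y v.swap) ?_ h
  · rw [← h1]
    refine Finset.sum_congr rfl fun y _ => Finset.sum_congr rfl fun x _ => ?_
    exact (setIntegral_prod_swap _ _ (φ x y)).symm
  · intro y x
    have := hi x y
    rw [IntegrableOn, Measure.volume_eq_prod, ← Measure.prod_restrict] at this ⊢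
    exact this.swap

/-- The pull-back of the form `ρ dx₀ ∧ dx₁ ∧ dx₂ ∧ dx₃` along `(p, q) ↦ F p - G q`, in charts. -/
noncomputable def degreeDensity (c c' : OpenPartialHomeomorph M Plane) (F G : M → FourSpace)
    (ρ : FourSpace → ℝ) (v : FourSpace) : ℝ :=
  ρ (F (c.symm v.1) - G (c'.symm v.2)) *
    (diffMap (fderiv ℝ (F ∘ c.symm) v.1) (fderiv ℝ (G ∘ c'.symm) v.2)).det

/-- If the density `ρ` is the first partial derivative of a smooth function, then its pull-back
along the difference of two maps of closed oriented surfaces to four-space has integral zero. -/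
theorem ChartPartition.sum_setIntegral_degreeDensity_eq_zero [CompactSpace M] [T2Space M] [IsManifold (𝓡 2) ∞ M]
    (P : ChartPartition o t) {F G : M → FourSpace} (hF : ContMDiff (𝓡 2) 𝓘(ℝ, FourSpace) ∞ F)
    (hG : ContMDiff (𝓡 2) 𝓘(ℝ, FourSpace) ∞ G) {η : FourSpace → ℝ} (hη : ContDiff ℝ ∞ η) :
    ∑ x ∈ t, ∑ y ∈ t, ∫ v in (P.chart x).target ×ˢ (P.chart y).target,
      P.weight x ((P.chart x).symm v.1) * P.weight y ((P.chart y).symm v.2) *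
        degreeDensity (P.chart x) (P.chart y) F G (fun u => fderiv ℝ η u (fourVec 0)) v = 0 := by
  have hm : ∀ x, P.chart x ∈ IsManifold.maximalAtlas (𝓡 2) ∞ M :=
    fun x => o.smooth (P.chart_mem x)
  have hcF : ∀ k, ContMDiff (𝓡 2) 𝓘(ℝ, ℝ) ∞ (fun p => coord k (F p)) := fun k =>
    (coord k).contMDiff.comp hF
  have hcG : ∀ k, ContMDiff (𝓡 2) 𝓘(ℝ, ℝ) ∞ (fun p => coord k (G p)) := fun k =>
    (coord k).contMDiff.comp hG
  have hηF : ∀ u, ContMDiff (𝓡 2) 𝓘(ℝ, ℝ) ∞ (fun p => η (F p - u)) := fun u =>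
    hη.contMDiff.comp (hF.sub contMDiff_const)
  have hηG : ∀ u, ContMDiff (𝓡 2) 𝓘(ℝ, ℝ) ∞ (fun q => η (u - G q)) := fun u =>
    hη.contMDiff.comp (contMDiff_const.sub hG)
  have hdF : ∀ x, ∀ z ∈ (P.chart x).target, DifferentiableAt ℝ (F ∘ (P.chart x).symm) z :=
    fun x z hz => (contDiffAt_comp_chart_symm (hm x) hF hz).differentiableAt (by simp)
  have hdG : ∀ x, ∀ z ∈ (P.chart x).target, DifferentiableAt ℝ (G ∘ (P.chart x).symm) z :=
    fun x z hz => (contDiffAt_comp_chart_symm (hm x) hG hz).differentiableAt (by simp)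
  have hcoord : ∀ (H : M → FourSpace) k x z, DifferentiableAt ℝ (H ∘ (P.chart x).symm) z →
      fderiv ℝ ((fun p => coord k (H p)) ∘ (P.chart x).symm) z =
        (coord k).comp (fderiv ℝ (H ∘ (P.chart x).symm) z) := by
    intro H k x z hd
    exact ((coord k).hasFDerivAt.comp z hd.hasFDerivAt).fderiv
  have hηd : ∀ u, HasFDerivAt η (fderiv ℝ η u) u := fun u =>
    (hη.differentiable (by simp) u).hasFDerivAt
  have hFη : ∀ x, ∀ z ∈ (P.chart x).target, ∀ u,
      fderiv ℝ ((fun p => η (F p - u)) ∘ (P.chart x).symm) z =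
        (fderiv ℝ η (F ((P.chart x).symm z) - u)).comp (fderiv ℝ (F ∘ (P.chart x).symm) z) :=
    fun x z hz u => ((hηd _).comp z ((hdF x z hz).hasFDerivAt.sub_const u)).fderiv
  have hGη : ∀ x, ∀ z ∈ (P.chart x).target, ∀ u,
      fderiv ℝ ((fun p => η (u - G p)) ∘ (P.chart x).symm) z =
        -(fderiv ℝ η (u - G ((P.chart x).symm z))).comp (fderiv ℝ (G ∘ (P.chart x).symm) z) := by
    intro x z hz u
    rw [← ContinuousLinearMap.comp_neg]
    exact ((hηd _).comp z ((hdG x z hz).hasFDerivAt.const_sub u)).fderiv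
  set L : M → M → FourSpace → FourSpace →L[ℝ] ℝ := fun x y v =>
    fderiv ℝ η (F ((P.chart x).symm v.1) - G ((P.chart y).symm v.2)) with hL
  set F' : M → FourSpace → Plane →L[ℝ] FourSpace := fun x v =>
    fderiv ℝ (F ∘ (P.chart x).symm) v.1 with hF'
  set G' : M → FourSpace → Plane →L[ℝ] FourSpace := fun y v =>
    fderiv ℝ (G ∘ (P.chart y).symm) v.2 with hG'
  have cL : ∀ x y, ContinuousOn (L x y) ((P.chart x).target ×ˢ (P.chart y).target) := by
    intro x y
    refine (hη.continuous_fderiv (by simp)).comp_continuousOn (ContinuousOn.sub ?_ ?_)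
    · exact (hF.continuous.comp_continuousOn (P.chart x).continuousOn_symm).comp
        continuousOn_fst fun v hv => hv.1
    · exact (hG.continuous.comp_continuousOn (P.chart y).continuousOn_symm).comp
        continuousOn_snd fun v hv => hv.2
  have cF' : ∀ x y, ContinuousOn (F' x) ((P.chart x).target ×ˢ (P.chart y).target) := fun x y =>
    (continuousOn_fderiv_comp_chart_symm (hm x) hF).comp continuousOn_fst fun v hv => hv.1
  have cG' : ∀ x y, ContinuousOn (G' y) ((P.chart x).target ×ˢ (P.chart y).target) := fun x y =>
    (continuousOn_fderiv_comp_chart_symm (hm y) hG).comp continuousOn_snd fun v hv => hv.2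
  set W : M → M → FourSpace → ℝ := fun x y v =>
    P.weight x ((P.chart x).symm v.1) * P.weight y ((P.chart y).symm v.2) with hW
  set α : Fin 4 → Fin 4 → Fin 4 → M → M → FourSpace → ℝ := fun k i j x y v => W x y v *
    (wedge ((L x y v).comp (F' x v)) ((coord k).comp (F' x v)) * minor (G' y v) i j) with hα
  set β : Fin 4 → Fin 4 → Fin 4 → M → M → FourSpace → ℝ := fun k i j x y v => W x y v *
    (minor (F' x v) i j * wedge ((L x y v).comp (G' y v)) ((coord k).comp (G' y v))) with hβ
  have iα : ∀ k i j x y,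
      IntegrableOn (α k i j x y) ((P.chart x).target ×ˢ (P.chart y).target) := fun k i j x y =>
    P.integrableOn_weight_mul_weight_mul x y
      ((((cL x y).clm_comp (cF' x y)).wedge (continuousOn_const.clm_comp (cF' x y))).mul
        ((continuousOn_const.clm_comp (cG' x y)).wedge (continuousOn_const.clm_comp (cG' x y))))
  have iβ : ∀ k i j x y,
      IntegrableOn (β k i j x y) ((P.chart x).target ×ˢ (P.chart y).target) := fun k i j x y =>
    P.integrableOn_weight_mul_weight_mul x y
      (((continuousOn_const.clm_comp (cF' x y)).wedge (continuousOn_const.clm_comp (cF' x y))).mul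
      (((cL x y).clm_comp (cG' x y)).wedge (continuousOn_const.clm_comp (cG' x y))))
  -- With q frozen, the first factor of α is the exact form d(a db) on M, for a = η(F - G q) and b
  -- the k-th coordinate of F; the remaining factor is constant in p.
  have zα : ∀ k i j, ∑ x ∈ t, ∑ y ∈ t,
      ∫ v in (P.chart x).target ×ˢ (P.chart y).target, α k i j x y v = 0 := by
    intro k i j
    refine P.sum_setIntegral_prod_eq_zero_of_left (iα k i j) fun y w hw => ?_
    have hS := P.sum_setIntegral_chartJac_eq_zero (hηF (G ((P.chart y).symm w))) (hcF k)
    calc _ = ∑ x ∈ t, (P.weight y ((P.chart y).symm w) * minor (G' y (0, w)) i j) *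
          ∫ z in (P.chart x).target, P.weight x ((P.chart x).symm z) * chartJac (P.chart x)
            (fun p => η (F p - G ((P.chart y).symm w))) (fun p => coord k (F p)) z := by
          refine Finset.sum_congr rfl fun x _ => ?_
          rw [← integral_const_mul]
          refine setIntegral_congr_fun (P.chart x).open_target.measurableSet fun z hz => ?_
          simp only [hα, chartJac, hFη x z hz, hcoord F k x z (hdF x z hz), hW, hL, hF', hG']
          ring
      _ = 0 := by rw [← Finset.mul_sum, hS, mul_zero]
  have zβ : ∀ k i j, ∑ x ∈ t, ∑ y ∈ t,
      ∫ v in (P.chart x).target ×ˢ (P.chart y).target, β k i j x y v = 0 := by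
    intro k i j
    refine P.sum_setIntegral_prod_eq_zero_of_right (iβ k i j) fun x z hz => ?_
    have hS := P.sum_setIntegral_chartJac_eq_zero (hηG (F ((P.chart x).symm z))) (hcG k)
    -- The minus sign compensates for differentiating η(F p - G q) with respect to q.
    calc _ = ∑ y ∈ t, (-(P.weight x ((P.chart x).symm z) * minor (F' x (z, 0)) i j)) *
          ∫ w in (P.chart y).target, P.weight y ((P.chart y).symm w) * chartJac (P.chart y)
            (fun q => η (F ((P.chart x).symm z) - G q)) (fun p => coord k (G p)) w := by
          refine Finset.sum_congr rfl fun y _ => ?_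
          rw [← integral_const_mul]
          refine setIntegral_congr_fun (P.chart y).open_target.measurableSet fun w hw => ?_
          simp only [hβ, chartJac, hGη y w hw, hcoord G k y w (hdG y w hw), hW, hL, hF', hG',
            wedge, neg_apply]
          ring
      _ = 0 := by rw [← Finset.mul_sum, hS, mul_zero]
  have hsum : ∀ x y, ∫ v in (P.chart x).target ×ˢ (P.chart y).target,
      P.weight x ((P.chart x).symm v.1) * P.weight y ((P.chart y).symm v.2) *
        degreeDensity (P.chart x) (P.chart y) F G (fun u => fderiv ℝ η u (fourVec 0)) v =
      (∫ v in (P.chart x).target ×ˢ (P.chart y).target, α 1 2 3 x y v)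
      - (∫ v in (P.chart x).target ×ˢ (P.chart y).target, α 2 1 3 x y v)
      + (∫ v in (P.chart x).target ×ˢ (P.chart y).target, α 3 1 2 x y v)
      + (∫ v in (P.chart x).target ×ˢ (P.chart y).target, β 3 1 2 x y v)
      - (∫ v in (P.chart x).target ×ˢ (P.chart y).target, β 2 1 3 x y v)
      + (∫ v in (P.chart x).target ×ˢ (P.chart y).target, β 1 2 3 x y v) := by
    intro x y
    rw [← integral_sub (iα 1 2 3 x y) (iα 2 1 3 x y), ← integral_add _ (iα 3 1 2 x y),
      ← integral_add _ (iβ 3 1 2 x y), ← integral_sub _ (iβ 2 1 3 x y),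
      ← integral_add _ (iβ 1 2 3 x y)]
    · congr 1
      ext v
      simp only [degreeDensity, apply_mul_det_diffMap, hα, hβ, hW, hL, hF', hG']
      ring
    · exact (((iα 1 2 3 x y).sub (iα 2 1 3 x y)).add (iα 3 1 2 x y)).add (iβ 3 1 2 x y)
        |>.sub (iβ 2 1 3 x y)
    · exact (((iα 1 2 3 x y).sub (iα 2 1 3 x y)).add (iα 3 1 2 x y)).add (iβ 3 1 2 x y)
    · exact ((iα 1 2 3 x y).sub (iα 2 1 3 x y)).add (iα 3 1 2 x y)
    · exact (iα 1 2 3 x y).sub (iα 2 1 3 x y)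
  simp only [hsum, Finset.sum_add_distrib, Finset.sum_sub_distrib, zα, zβ]
  simp

end DegreeIntegral

/-! ### A bump density with a primitive -/

theorem norm_fourSpace_lt {u : FourSpace} {δ : ℝ} (h : ∀ k, |coord k u| < δ / 2) : ‖u‖ < δ := by
  have hp : ∀ v : Plane, |v 0| < δ / 2 → |v 1| < δ / 2 → ‖v‖ < δ := by
    intro v h0 h1
    rw [plane_eq_sum v]
    refine (norm_add_le _ _).trans_lt ?_
    simp only [norm_smul, planeVec, PiLp.norm_single, Real.norm_eq_abs, abs_one, mul_one]
    linarith
  rw [Prod.norm_def, max_lt_iff]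
  exact ⟨hp _ (h 0) (h 1), hp _ (h 2) (h 3)⟩

/-- A bump density near the origin of four-space which is a first partial derivative. -/
theorem exists_bump_partialDeriv {δ : ℝ} (hδ : 0 < δ) : ∃ η : FourSpace → ℝ, ContDiff ℝ ∞ η ∧
    (∀ u, δ ≤ ‖u‖ → fderiv ℝ η u (fourVec 0) = 0) ∧ 0 < ∫ u, fderiv ℝ η u (fourVec 0) := by
  let b : ContDiffBump (0 : ℝ) := ⟨δ / 8, δ / 4, by positivity, by linarith⟩
  -- The primitive `B` takes different constant values far to the left and far to the right, so η is
  -- not compactly supported. It could not be, since ∫ ∂₀η > 0; compactness of M makes this harmless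
  -- in Stokes' theorem.
  set B : ℝ → ℝ := fun x => ∫ s in (0 : ℝ)..x, b s with hB
  have hBd : ∀ x, HasDerivAt B (b x) x := fun x =>
    intervalIntegral.integral_hasDerivAt_right (b.continuous.intervalIntegrable _ _)
      (b.continuous.stronglyMeasurableAtFilter _ _) b.continuous.continuousAt
  have hBs : ContDiff ℝ ∞ B := by
    rw [contDiff_infty_iff_deriv]
    refine ⟨fun x => (hBd x).differentiableAt, ?_⟩
    rw [show deriv B = b from funext fun x => (hBd x).deriv]
    exact b.contDiff
  set η : FourSpace → ℝ := fun u => B (coord 0 u) * (b (coord 1 u) * b (coord 2 u) * b (coord 3 u))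
    with hη
  have hηs : ContDiff ℝ ∞ η :=
    (hBs.comp (coord 0).contDiff).mul (((b.contDiff.comp (coord 1).contDiff).mul
      (b.contDiff.comp (coord 2).contDiff)).mul (b.contDiff.comp (coord 3).contDiff))
  have hρ : ∀ u, fderiv ℝ η u (fourVec 0) =
      b (coord 0 u) * (b (coord 1 u) * b (coord 2 u) * b (coord 3 u)) := by
    intro u
    have h1 : HasDerivAt (fun s : ℝ => η (u + s • fourVec 0)) (fderiv ℝ η u (fourVec 0)) 0 :=
      (hηs.differentiable (by simp) u).hasFDerivAt.hasLineDerivAt (fourVec 0)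
    have h2 : (fun s : ℝ => η (u + s • fourVec 0)) = fun s =>
        B (coord 0 u + s) * (b (coord 1 u) * b (coord 2 u) * b (coord 3 u)) := by
      ext s; simp [hη, coord, fourVec, planeVec]
    rw [h2] at h1
    have h3 : HasDerivAt (fun s => B (coord 0 u + s)) (b (coord 0 u)) 0 := by
      have h4 := hBd (coord 0 u + 0)
      rw [add_zero] at h4
      have := HasDerivAt.comp_const_add (coord 0 u) 0 (by simpa using h4)
      exact this
    exact h1.unique (h3.mul_const _)
  have hzero : ∀ u, δ ≤ ‖u‖ → fderiv ℝ η u (fourVec 0) = 0 := by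
    intro u hu
    by_contra hne
    refine (norm_fourSpace_lt (u := u) (δ := δ) fun k => ?_).not_ge hu
    have hk : b (coord k u) ≠ 0 := by
      intro h0
      apply hne
      rw [hρ]
      fin_cases k <;> simp_all
    have : coord k u ∈ Metric.ball (0 : ℝ) (δ / 4) := by
      rw [← b.support_eq]; exact hk
    rw [mem_ball_zero_iff, Real.norm_eq_abs] at this
    linarith
  refine ⟨η, hηs, hzero, ?_⟩
  have hc : Continuous fun u => fderiv ℝ η u (fourVec 0) :=
    (hηs.continuous_fderiv (by simp)).clm_apply continuous_const
  refine hc.integral_pos_of_hasCompactSupport_nonneg_nonzero (x := 0) ?_ ?_ ?_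
  · refine HasCompactSupport.intro (isCompact_closedBall (0 : FourSpace) δ) fun u hu => hzero u ?_
    rw [mem_closedBall_zero_iff, not_le] at hu
    exact hu.le
  · intro u
    change 0 ≤ fderiv ℝ η u (fourVec 0)
    rw [hρ]
    have := fun k => b.nonneg (x := coord k u)
    exact mul_nonneg (this 0) (mul_nonneg (mul_nonneg (this 1) (this 2)) (this 3))
  · rw [hρ]
    have : b (0 : ℝ) = 1 := b.one_of_mem_closedBall (by simp [b.rIn_pos.le])
    simp [this]

/-! ### Local contributions and the vanishing of the degree -/

section Degree

variable {M : Type*} [TopologicalSpace M] [ChartedSpace Plane M]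

theorem hasStrictFDerivAt_diffMap {c : OpenPartialHomeomorph M Plane}
    (hc : c ∈ IsManifold.maximalAtlas (𝓡 2) ∞ M) {F G : M → FourSpace}
    (hF : ContMDiff (𝓡 2) 𝓘(ℝ, FourSpace) ∞ F) (hG : ContMDiff (𝓡 2) 𝓘(ℝ, FourSpace) ∞ G)
    {v : FourSpace} (hv : v ∈ c.target ×ˢ c.target) :
    HasStrictFDerivAt (fun v : FourSpace => F (c.symm v.1) - G (c.symm v.2))
      (diffMap (fderiv ℝ (F ∘ c.symm) v.1) (fderiv ℝ (G ∘ c.symm) v.2)) v := by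
  have h1 := (contDiffAt_comp_chart_symm hc hF hv.1).hasStrictFDerivAt (by simp)
  have h2 := (contDiffAt_comp_chart_symm hc hG hv.2).hasStrictFDerivAt (by simp)
  exact (h1.comp v hasStrictFDerivAt_fst).sub (h2.comp v hasStrictFDerivAt_snd)

/-- A neighbourhood of a nondegenerate coincidence of two maps to four-space on which the
difference of the maps is injective and has a Jacobian determinant of constant sign. -/
theorem exists_nhds_injOn_diff {c : OpenPartialHomeomorph M Plane}
    (hc : c ∈ IsManifold.maximalAtlas (𝓡 2) ∞ M) {F G : M → FourSpace}
    (hF : ContMDiff (𝓡 2) 𝓘(ℝ, FourSpace) ∞ F) (hG : ContMDiff (𝓡 2) 𝓘(ℝ, FourSpace) ∞ G)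
    {p : M} (hp : p ∈ c.source) (hFG : F p = G p) {O : Set M} (hO : O ∈ 𝓝 p) {D : ℝ}
    (hD : D = (diffMap (fderiv ℝ (F ∘ c.symm) (c p)) (fderiv ℝ (G ∘ c.symm) (c p))).det)
    (hD0 : D ≠ 0) :
    ∃ N : Set FourSpace, IsOpen N ∧ (c p, c p) ∈ N ∧ N ⊆ c.target ×ˢ c.target ∧
      (∀ v ∈ N, c.symm v.1 ∈ O ∧ c.symm v.2 ∈ O) ∧
      InjOn (fun v : FourSpace => F (c.symm v.1) - G (c.symm v.2)) N ∧
      (∀ v ∈ N, SignType.sign (diffMap (fderiv ℝ (F ∘ c.symm) v.1)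
        (fderiv ℝ (G ∘ c.symm) v.2)).det = SignType.sign D) ∧
      ∃ ε > 0, Metric.ball 0 ε ⊆ (fun v : FourSpace => F (c.symm v.1) - G (c.symm v.2)) '' N := by
  set Φ : FourSpace → FourSpace := fun v => F (c.symm v.1) - G (c.symm v.2) with hΦ
  set v₀ : FourSpace := (c p, c p) with hv₀
  have hT : IsOpen (c.target ×ˢ c.target) := c.open_target.prod c.open_target
  have hv₀T : v₀ ∈ c.target ×ˢ c.target := ⟨c.map_source hp, c.map_source hp⟩
  have hstr := hasStrictFDerivAt_diffMap hc hF hG hv₀T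
  have hdet0 : (diffMap (fderiv ℝ (F ∘ c.symm) v₀.1) (fderiv ℝ (G ∘ c.symm) v₀.2)).det ≠ 0 := by
    rw [← hD]; exact hD0
  set E : FourSpace ≃L[ℝ] FourSpace :=
    ContinuousLinearMap.toContinuousLinearEquivOfDetNeZero _ hdet0
  have hstr' : HasStrictFDerivAt Φ (E : FourSpace →L[ℝ] FourSpace) v₀ := hstr
  set e := hstr'.toOpenPartialHomeomorph Φ
  have hcontdet : ContinuousAt (fun v : FourSpace => (diffMap (fderiv ℝ (F ∘ c.symm) v.1)
      (fderiv ℝ (G ∘ c.symm) v.2)).det) v₀ := by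
    have h1 : ContinuousOn (fun v : FourSpace => (diffMap (fderiv ℝ (F ∘ c.symm) v.1)
      (fderiv ℝ (G ∘ c.symm) v.2)).det) (c.target ×ˢ c.target) := by
      refine ContinuousLinearMap.continuous_det.comp_continuousOn (ContinuousOn.sub ?_ ?_)
      · exact ((continuousOn_fderiv_comp_chart_symm hc hF).comp continuousOn_fst
          fun v hv => hv.1).clm_comp continuousOn_const
      · exact ((continuousOn_fderiv_comp_chart_symm hc hG).comp continuousOn_snd
          fun v hv => hv.2).clm_comp continuousOn_const
    exact h1.continuousAt (hT.mem_nhds hv₀T)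
  have hO1 : ∀ᶠ z in 𝓝 (c p), c.symm z ∈ O := by
    have := c.symm.continuousAt (c.map_source hp)
    rw [ContinuousAt, c.left_inv hp] at this
    exact this hO
  have hev : ∀ᶠ v in 𝓝 v₀, v ∈ c.target ×ˢ c.target ∧ v ∈ e.source ∧
      (c.symm v.1 ∈ O ∧ c.symm v.2 ∈ O) ∧ SignType.sign (diffMap (fderiv ℝ (F ∘ c.symm) v.1)
        (fderiv ℝ (G ∘ c.symm) v.2)).det = SignType.sign D := by
    refine (hT.eventually_mem hv₀T).and ((e.open_source.eventually_mem
      (hstr'.mem_toOpenPartialHomeomorph_source)).and (((hO1.prod_nhds hO1)).and ?_))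
    rcases lt_or_gt_of_ne hD0 with h | h
    · filter_upwards [hcontdet.eventually_lt_const (hD.symm.trans_lt h)] with v hv
      rw [sign_neg hv, sign_neg h]
    · filter_upwards [hcontdet.eventually_const_lt (h.trans_eq hD)] with v hv
      rw [sign_pos hv, sign_pos h]
  obtain ⟨N, hN, hNo, hvN⟩ := eventually_nhds_iff.1 hev
  refine ⟨N, hNo, hvN, fun v hv => (hN v hv).1, fun v hv => (hN v hv).2.2.1, ?_,
    fun v hv => (hN v hv).2.2.2, ?_⟩
  · exact e.injOn.mono fun v hv => (hN v hv).2.1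
  · have h1 : Φ '' N ∈ 𝓝 (Φ v₀) := by
      rw [← hstr'.map_nhds_eq_of_equiv]; exact image_mem_map (hNo.mem_nhds hvN)
    have h2 : Φ v₀ = 0 := by simp [hΦ, hv₀, c.left_inv hp, hFG]
    rw [h2] at h1
    exact Metric.mem_nhds_iff.1 h1

end Degree

theorem isAddHaarMeasure_fourSpace : (volume : Measure FourSpace).IsAddHaarMeasure :=
  inferInstanceAs (((volume : Measure Plane).prod volume).IsAddHaarMeasure)

section Degree

variable {M : Type*} [TopologicalSpace M] [ChartedSpace Plane M]

/-- The difference map is injective on N and its image contains the support of ρ, so change of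
variables recovers ∫ρ; the constant sign turns |det| into det. -/
theorem sign_mul_setIntegral_eq {c : OpenPartialHomeomorph M Plane}
    (hc : c ∈ IsManifold.maximalAtlas (𝓡 2) ∞ M) {F G : M → FourSpace}
    (hF : ContMDiff (𝓡 2) 𝓘(ℝ, FourSpace) ∞ F) (hG : ContMDiff (𝓡 2) 𝓘(ℝ, FourSpace) ∞ G)
    {N : Set FourSpace} (hN : IsOpen N) (hNT : N ⊆ c.target ×ˢ c.target)
    (hinj : InjOn (fun v : FourSpace => F (c.symm v.1) - G (c.symm v.2)) N) {D : ℝ}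
    (hD : ∀ v ∈ N, SignType.sign (diffMap (fderiv ℝ (F ∘ c.symm) v.1)
        (fderiv ℝ (G ∘ c.symm) v.2)).det = SignType.sign D)
    {ρ : FourSpace → ℝ} {ε : ℝ}
    (hε : Metric.ball 0 ε ⊆ (fun v : FourSpace => F (c.symm v.1) - G (c.symm v.2)) '' N)
    (hρ : ∀ u, ε ≤ ‖u‖ → ρ u = 0) :
    ∫ v in N, degreeDensity c c F G ρ v = (SignType.sign D : ℝ) * ∫ u, ρ u := by
  have := isAddHaarMeasure_fourSpace
  set Φ : FourSpace → FourSpace := fun v => F (c.symm v.1) - G (c.symm v.2) with hΦ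
  have h1 : ∫ u, ρ u = ∫ u in Φ '' N, ρ u := by
    refine (setIntegral_eq_integral_of_forall_compl_eq_zero fun u hu => hρ u ?_).symm
    by_contra h
    exact hu (hε (by rw [mem_ball_zero_iff]; exact not_le.1 h))
  rw [h1, integral_image_eq_integral_abs_det_fderiv_smul volume hN.measurableSet
    (fun v hv => (hasStrictFDerivAt_diffMap hc hF hG (hNT hv)).hasFDerivAt.hasFDerivWithinAt) hinj,
    ← integral_const_mul]
  refine setIntegral_congr_fun hN.measurableSet fun v hv => ?_
  simp only [degreeDensity, smul_eq_mul, ← hD v hv]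
  rw [← mul_assoc, sign_mul_abs, mul_comm]

/-- The signed number of coincidences of two maps of a closed oriented surface to four-space
vanishes, if all coincidences are nondegenerate and lie on the diagonal. -/
theorem sum_sign_det_diffMap_eq_zero [CompactSpace M] [T2Space M] [IsManifold (𝓡 2) ∞ M]
    (o : SurfaceOrientation M) {c : M → OpenPartialHomeomorph M Plane}
    (hc : ∀ x, c x ∈ o.charts) (hcx : ∀ x, x ∈ (c x).source) {F G : M → FourSpace}
    (hF : ContMDiff (𝓡 2) 𝓘(ℝ, FourSpace) ∞ F) (hG : ContMDiff (𝓡 2) 𝓘(ℝ, FourSpace) ∞ G)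
    {Z : Finset M} (hZ : ∀ p q, F p = G q → p = q ∧ p ∈ Z) (hZ' : ∀ p ∈ Z, F p = G p)
    {D : M → ℝ} (hD : ∀ p ∈ Z, D p = (diffMap (fderiv ℝ (F ∘ (c p).symm) (c p p))
      (fderiv ℝ (G ∘ (c p).symm) (c p p))).det) (hD0 : ∀ p ∈ Z, D p ≠ 0) :
    ∑ p ∈ Z, (SignType.sign (D p) : ℤ) = 0 := by
  classical
  -- Every point of Z other than x is removed from the domain allowed to the weight of x. Hence near
  -- z ∈ Z only the weight of z survives, and it equals 1 there.
  obtain ⟨t, P, rfl, hPU⟩ := exists_chartPartition o c hc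
    (fun x => (c x).source ∩ (↑(Z.erase x) : Set M)ᶜ)
    (fun x => (c x).open_source.inter (Z.erase x).finite_toSet.isClosed.isOpen_compl)
    (fun x => ⟨hcx x, by simp⟩) (fun x => inter_subset_left)
  have hm : ∀ x, P.chart x ∈ IsManifold.maximalAtlas (𝓡 2) ∞ M := fun x => o.smooth (hc x)
  have hO : ∀ z ∈ Z, ∀ᶠ p in 𝓝 z, ∀ x ∈ t, x ≠ z → P.weight x p = 0 := by
    intro z hz
    rw [Filter.eventually_all_finset]
    intro x _
    by_cases hxz : x = z
    · simp [hxz]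
    · have : z ∉ tsupport (P.weight x) := fun h => by
        have := (hPU x h).2
        simp [hz, Ne.symm hxz] at this
      filter_upwards [(isClosed_tsupport (P.weight x)).isOpen_compl.mem_nhds this] with p hp _
      exact image_eq_zero_of_notMem_tsupport hp
  have hone : ∀ z p, (∀ x ∈ t, x ≠ z → P.weight x p = 0) → z ∈ t ∧ P.weight z p = 1 := by
    intro z p h
    have hs := P.sum_eq_one p
    by_cases hzt : z ∈ t
    · rw [Finset.sum_eq_single_of_mem z hzt h] at hs; exact ⟨hzt, hs⟩
    · rw [Finset.sum_eq_zero fun x hx => h x hx fun h => hzt (h ▸ hx)] at hs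
      exact absurd hs zero_ne_one
  have hZt : Z ⊆ t := fun z hz => (hone z z (hO z hz).self_of_nhds).1
  choose! N hNo hzN hNT hNO hinj hsgn ε hε hball using fun z (hz : z ∈ Z) =>
    exists_nhds_injOn_diff (hm z) hF hG (hcx z) (hZ' z hz) (hO z hz) (hD z hz) (hD0 z hz)
  -- `R z` is the neighbourhood `N z` of (z, z) carried back to M × M. All coincidences lie in these
  -- sets, so by compactness ‖F p - G q‖ is bounded below outside them.
  set R : M → Set (M × M) := fun z => ((P.chart z).prod (P.chart z)).source ∩
    ((P.chart z).prod (P.chart z)) ⁻¹' (N z) with hR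
  have hRo : ∀ z ∈ Z, IsOpen (R z) := fun z hz =>
    ((P.chart z).prod (P.chart z)).isOpen_inter_preimage (hNo z hz)
  have hQ : IsCompact (⋃ z ∈ Z, R z)ᶜ := (isOpen_biUnion hRo).isClosed_compl.isCompact
  obtain ⟨δ₀, hδ₀, hfar⟩ := hQ.exists_forall_le' (f := fun x : M × M => ‖F x.1 - G x.2‖) (a := 0)
    ((hF.continuous.comp continuous_fst).sub (hG.continuous.comp continuous_snd)).norm.continuousOn
    (by
      rintro ⟨p, q⟩ hpq
      rw [norm_pos_iff, sub_ne_zero]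
      intro h
      obtain ⟨rfl, hp⟩ := hZ p q h
      exact hpq (mem_biUnion hp ⟨⟨hcx p, hcx p⟩, hzN p hp⟩))
  -- The support of ρ must be too small to be reached outside the sets `R z`, and must fit into the
  -- image of each `N z`.
  obtain ⟨δ, hδ, hδδ₀, hδε⟩ : ∃ δ > 0, δ ≤ δ₀ ∧ ∀ z ∈ Z, δ ≤ ε z := by
    have h1 : ∀ᶠ δ in 𝓝[>] (0 : ℝ), δ ≤ δ₀ ∧ ∀ z ∈ Z, δ ≤ ε z := by
      refine nhdsWithin_le_nhds ((ge_mem_nhds hδ₀).and ?_)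
      rw [Filter.eventually_all_finset]
      exact fun z hz => ge_mem_nhds (hε z hz)
    obtain ⟨δ, h2, h3⟩ := (h1.and self_mem_nhdsWithin).exists
    exact ⟨δ, h3, h2⟩
  obtain ⟨η, hη, hη0, hηpos⟩ := exists_bump_partialDeriv hδ
  set ρ : FourSpace → ℝ := fun u => fderiv ℝ η u (fourVec 0) with hρ
  have hmain := P.sum_setIntegral_degreeDensity_eq_zero hF hG hη
  set φ : M → M → FourSpace → ℝ := fun x y v =>
    P.weight x ((P.chart x).symm v.1) * P.weight y ((P.chart y).symm v.2) *
      degreeDensity (P.chart x) (P.chart y) F G ρ v with hφ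
  -- A nonzero integrand places the pair of points in some `R z`, where every weight except that of
  -- z vanishes; so both indices equal z.
  have hloc : ∀ x ∈ t, ∀ y ∈ t, ∀ v ∈ (P.chart x).target ×ˢ (P.chart y).target, φ x y v ≠ 0 →
      x ∈ Z ∧ y = x ∧ v ∈ N x := by
    rintro x hx y hy ⟨v₁, v₂⟩ ⟨hv₁, hv₂⟩ hne
    have hρne : ρ (F ((P.chart x).symm v₁) - G ((P.chart y).symm v₂)) ≠ 0 := by
      intro h; apply hne; simp [hφ, degreeDensity, h]
    have hwx : P.weight x ((P.chart x).symm v₁) ≠ 0 := by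
      intro h; apply hne; simp [hφ, h]
    have hwy : P.weight y ((P.chart y).symm v₂) ≠ 0 := by
      intro h; apply hne; simp [hφ, h]
    have hmem : ((P.chart x).symm v₁, (P.chart y).symm v₂) ∈ ⋃ z ∈ Z, R z := by
      by_contra h
      have hle : δ₀ ≤ ‖F ((P.chart x).symm v₁) - G ((P.chart y).symm v₂)‖ :=
        hfar ((P.chart x).symm v₁, (P.chart y).symm v₂) (mem_compl h)
      exact hρne (hη0 _ (hδδ₀.trans hle))
    simp only [mem_iUnion] at hmem
    obtain ⟨z, hz, hsrc, hzv⟩ := hmem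
    have hs1 : (P.chart x).symm v₁ ∈ (P.chart z).source := hsrc.1
    have hs2 : (P.chart y).symm v₂ ∈ (P.chart z).source := hsrc.2
    have hzv' : (P.chart z ((P.chart x).symm v₁), P.chart z ((P.chart y).symm v₂)) ∈ N z := hzv
    have hO12 := hNO z hz _ hzv'
    simp only [(P.chart z).left_inv hs1, (P.chart z).left_inv hs2] at hO12
    have hxz : x = z := by
      by_contra h; exact hwx (hO12.1 x hx h)
    have hyz : y = z := by
      by_contra h; exact hwy (hO12.2 y hy h)
    subst hxz; subst hyz
    rw [(P.chart y).right_inv hv₁, (P.chart y).right_inv hv₂] at hzv'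
    exact ⟨hz, rfl, hzv'⟩
  have hoff : ∀ x ∈ t, ∀ y ∈ t, ¬ (x ∈ Z ∧ y = x) →
      ∫ v in (P.chart x).target ×ˢ (P.chart y).target, φ x y v = 0 := by
    intro x hx y hy hxy
    refine setIntegral_eq_zero_of_forall_eq_zero fun v hv => ?_
    by_contra h
    have := hloc x hx y hy v hv h
    exact hxy ⟨this.1, this.2.1⟩
  have hdiag : ∀ z ∈ Z, ∫ v in (P.chart z).target ×ˢ (P.chart z).target, φ z z v =
      (SignType.sign (D z) : ℝ) * ∫ u, ρ u := by
    intro z hz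
    rw [← sign_mul_setIntegral_eq (hm z) hF hG (hNo z hz) (hNT z hz) (hinj z hz) (hsgn z hz)
      (hball z hz) (fun u hu => hη0 u ((hδε z hz).trans hu))]
    rw [setIntegral_eq_of_subset_of_forall_sdiff_eq_zero
      ((P.chart z).open_target.prod (P.chart z).open_target).measurableSet (hNT z hz)
      (fun v hv => by
        by_contra h
        exact hv.2 (hloc z (hZt hz) z (hZt hz) v hv.1 h).2.2)]
    refine setIntegral_congr_fun (hNo z hz).measurableSet fun v hv => ?_
    have h12 := hNO z hz v hv
    simp only [hφ, (hone z _ h12.1).2, (hone z _ h12.2).2, one_mul]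
    rfl
  have hfinal : ∑ z ∈ Z, (SignType.sign (D z) : ℝ) * ∫ u, ρ u = 0 := by
    rw [← hmain]
    refine (Finset.sum_subset_zero_on_sdiff hZt ?_ ?_)
    · intro x hx
      rw [Finset.mem_sdiff] at hx
      exact Finset.sum_eq_zero fun y hy => hoff x hx.1 y hy fun h => hx.2 h.1
    · intro x hx
      rw [← hdiag x hx]
      exact (Finset.sum_eq_single_of_mem x (hZt hx) fun y hy hyx =>
        hoff x (hZt hx) y hy fun h => hyx h.2).symm
  rw [← Finset.sum_mul] at hfinal
  have := (mul_eq_zero.1 hfinal).resolve_right hηpos.ne'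
  have hcast : ((∑ p ∈ Z, (SignType.sign (D p) : ℤ) : ℤ) : ℝ) = 0 := by
    rw [← this]; push_cast
    refine Finset.sum_congr rfl fun p _ => ?_
    cases SignType.sign (D p) <;> simp
  exact_mod_cast hcast

end Degree

/-! ### Stereographic projection and its effect on orientation -/

section Stereographic

variable (b : OrthonormalBasis (Fin 5) ℝ E5)

/-- The coordinates, with respect to the last four vectors of an orthonormal basis, of the
orthogonal projection to the hyperplane spanned by these vectors. -/
noncomputable def hyperplaneProj : E5 →L[ℝ] FourSpace :=
  ∑ k : Fin 4, (innerSL ℝ (b k.succ)).smulRight (fourVec k)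

/-- Stereographic projection from the first vector of an orthonormal basis, extended to be
constant on rays through the origin. -/
noncomputable def rayStereo (x : E5) : FourSpace :=
  (‖x‖ - inner ℝ (b 0) x)⁻¹ • hyperplaneProj b x

theorem coord_hyperplaneProj (k : Fin 4) (x : E5) :
    coord k (hyperplaneProj b x) = inner ℝ (b k.succ) x := by
  simp only [hyperplaneProj, Fin.sum_univ_four]
  fin_cases k <;> simp [coord, fourVec, planeVec]

theorem contDiffAt_rayStereo {x : E5} (hx : x ≠ 0) (hb : inner ℝ (b 0) x ≠ ‖x‖) :
    ContDiffAt ℝ ∞ (rayStereo b) x := by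
  have h1 : ContDiffAt ℝ ∞ (fun y : E5 => ‖y‖ - inner ℝ (b 0) y) x :=
    (contDiffAt_norm ℝ hx).sub (innerSL ℝ (b 0)).contDiff.contDiffAt
  exact (h1.inv (sub_ne_zero.2 (Ne.symm hb))).smul (hyperplaneProj b).contDiff.contDiffAt

/-- Invariance under scaling allows the push-off f + εs to be projected without normalizing it
first, which keeps its derivative simple. -/
theorem rayStereo_smul {r : ℝ} (hr : 0 < r) (x : E5) : rayStereo b (r • x) = rayStereo b x := by
  simp only [rayStereo, norm_smul, Real.norm_eq_abs, abs_of_pos hr, map_smul, inner_smul_right,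
    smul_smul, ← mul_sub, mul_inv]
  congr 1
  field_simp

theorem norm_sq_eq_coords (x : E5) : ‖x‖ ^ 2 = inner ℝ (b 0) x ^ 2 +
    ∑ k : Fin 4, coord k (hyperplaneProj b x) ^ 2 := by
  rw [← b.sum_sq_norm_inner_right x, Fin.sum_univ_succ]
  simp [coord_hyperplaneProj]

theorem rayStereo_injective_of_norm_one {x y : E5} (hx : ‖x‖ = 1) (hy : ‖y‖ = 1)
    (hbx : inner ℝ (b 0) x ≠ (1 : ℝ)) (hby : inner ℝ (b 0) y ≠ (1 : ℝ))
    (h : rayStereo b x = rayStereo b y) : x = y := by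
  have hc : ∀ k, (1 - inner ℝ (b 0) x)⁻¹ * coord k (hyperplaneProj b x) =
      (1 - inner ℝ (b 0) y)⁻¹ * coord k (hyperplaneProj b y) := by
    intro k
    have := congrArg (coord k) h
    simpa [rayStereo, hx, hy] using this
  have hnx := norm_sq_eq_coords b x
  have hny := norm_sq_eq_coords b y
  rw [hx] at hnx
  rw [hy] at hny
  have hα : 1 - inner ℝ (b 0) x ≠ 0 := sub_ne_zero.2 (Ne.symm hbx)
  have hβ : 1 - inner ℝ (b 0) y ≠ 0 := sub_ne_zero.2 (Ne.symm hby)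
  have hxk : ∀ k, coord k (hyperplaneProj b x) = (1 - inner ℝ (b 0) x) *
      ((1 - inner ℝ (b 0) x)⁻¹ * coord k (hyperplaneProj b x)) := fun k => by
    rw [mul_inv_cancel_left₀ hα]
  have hyk : ∀ k, coord k (hyperplaneProj b y) = (1 - inner ℝ (b 0) y) *
      ((1 - inner ℝ (b 0) x)⁻¹ * coord k (hyperplaneProj b x)) := fun k => by
    rw [hc, mul_inv_cancel_left₀ hβ]
  generalize hw : (fun k => (1 - inner ℝ (b 0) x)⁻¹ * coord k (hyperplaneProj b x)) = w at *
  have hxw : ∀ k, coord k (hyperplaneProj b x) = (1 - inner ℝ (b 0) x) * w k := fun k => by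
    rw [← hw]; exact hxk k
  have hyw : ∀ k, coord k (hyperplaneProj b y) = (1 - inner ℝ (b 0) y) * w k := fun k => by
    rw [← hw]; exact hyk k
  simp only [hxw, mul_pow, ← Finset.mul_sum] at hnx
  simp only [hyw, mul_pow, ← Finset.mul_sum] at hny
  set S := ∑ k, w k ^ 2
  have hS : 0 ≤ S := Finset.sum_nonneg fun k _ => sq_nonneg _
  -- With x₀ the height of x, the equation 1 = x₀² + (1 - x₀)² S, divided by 1 - x₀, becomes (1 -
  -- x₀)(1 + S) = 2. Thus the projected point determines the height, and then all coordinates.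
  have e1 : (1 - inner ℝ (b 0) x) * (1 + S) = 2 :=
    mul_left_cancel₀ hα (by linear_combination -hnx)
  have e2 : (1 - inner ℝ (b 0) y) * (1 + S) = 2 :=
    mul_left_cancel₀ hβ (by linear_combination -hny)
  have e3 : 1 - inner ℝ (b 0) x = 1 - inner ℝ (b 0) y :=
    mul_right_cancel₀ (show (1 + S) ≠ 0 by positivity) (e1.trans e2.symm)
  apply b.repr.injective
  ext i
  rw [b.repr_apply_apply, b.repr_apply_apply]
  refine Fin.cases ?_ (fun k => ?_) i
  · linarith
  · simp only [← coord_hyperplaneProj, hxw, hyw, e3]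

theorem inner_lt_norm_of_ne {x : E5} (hx : ‖x‖ = 1) (hb : x ≠ b 0) : inner ℝ (b 0) x ≠ (1 : ℝ) :=
  fun h => hb ((inner_eq_one_iff_of_norm_eq_one (b.norm_eq_one 0) hx).1 h).symm

/-- For v tangent to the sphere the derivative of the norm vanishes, so the denominator varies only
through the height ⟨b₀, ·⟩. -/
theorem fderiv_rayStereo {x v : E5} (hx : ‖x‖ = 1) (hb : inner ℝ (b 0) x ≠ (1 : ℝ))
    (hv : inner ℝ x v = (0 : ℝ)) (k : Fin 4) :
    coord k (fderiv ℝ (rayStereo b) x v) =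
      (1 - inner ℝ (b 0) x)⁻¹ * (inner ℝ (b k.succ) v +
        (1 - inner ℝ (b 0) x)⁻¹ * inner ℝ (b 0) v * inner ℝ (b k.succ) x) := by
  have hx0 : x ≠ 0 := by rintro rfl; simp at hx
  have hn : DifferentiableAt ℝ (fun y : E5 => ‖y‖) x :=
    (contDiffAt_norm ℝ hx0 (n := 1)).differentiableAt (by simp)
  have hn' : fderiv ℝ (fun y : E5 => ‖y‖) x v = 0 := by
    have h1 : HasFDerivAt (fun y : E5 => ‖y‖ ^ 2) (2 • innerSL ℝ x) x :=
      (hasStrictFDerivAt_norm_sq x).hasFDerivAt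
    have h2 := hn.hasFDerivAt.pow 2
    have h3 := congrArg (fun l : E5 →L[ℝ] ℝ => l v) (h1.unique h2)
    simp [hx, hv] at h3
    exact h3
  have hd : HasFDerivAt (fun y : E5 => ‖y‖ - inner ℝ (b 0) y)
      (fderiv ℝ (fun y : E5 => ‖y‖) x - innerSL ℝ (b 0)) x :=
    hn.hasFDerivAt.sub (innerSL ℝ (b 0)).hasFDerivAt
  have hα : ‖x‖ - inner ℝ (b 0) x ≠ 0 := by rw [hx]; exact sub_ne_zero.2 (Ne.symm hb)
  have hi := (hasFDerivAt_inv hα).comp x hd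
  have hs := hi.smul (hyperplaneProj b).hasFDerivAt
  have : fderiv ℝ (rayStereo b) x = _ := hs.fderiv
  rw [this]
  simp [hn', coord_hyperplaneProj, hx]
  generalize (1 - inner ℝ (b 0) x : ℝ) = α
  ring

/-- The sign of this determinant is left undetermined: it is the same at all zeros and can be
cancelled at the end. -/
theorem det_orthonormalBasis_ne_zero :
    Matrix.det (Matrix.of fun i j : Fin 5 => b j i) ≠ 0 := by
  intro h
  have h1 : (Matrix.of fun i j : Fin 5 => b j i).transpose * (Matrix.of fun i j : Fin 5 => b j i)
      = 1 := by
    ext i j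
    have := orthonormal_iff_ite.1 b.orthonormal j i
    rw [PiLp.inner_apply] at this
    simp only [Matrix.mul_apply, Matrix.transpose_apply, Matrix.of_apply, Matrix.one_apply]
    simp only [RCLike.inner_apply, conj_trivial] at this
    rw [this]
    simp [eq_comm]
  have h2 := congrArg Matrix.det h1
  rw [Matrix.det_mul, h] at h2
  simp at h2

theorem det_arrow (x : Fin 5 → ℝ) (a : ℝ) :
    Matrix.det (Matrix.of fun i j : Fin 5 => if j = 0 then x i else
      (if i = j then 1 else 0) + if i = 0 then a * x j else 0) =
    x 0 - a * (x 1 ^ 2 + x 2 ^ 2 + x 3 ^ 2 + x 4 ^ 2) := by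
  have e : (Matrix.of fun i j : Fin 5 => if j = 0 then x i else
      (if i = j then 1 else 0) + if i = 0 then a * x j else 0) =
      !![x 0, a * x 1, a * x 2, a * x 3, a * x 4;
         x 1, 1, 0, 0, 0; x 2, 0, 1, 0, 0; x 3, 0, 0, 1, 0; x 4, 0, 0, 0, 1] := by
    ext i j
    fin_cases i <;> fin_cases j <;> simp
  rw [e]
  simp [Matrix.det_succ_row_zero, Fin.sum_univ_succ, Fin.succAbove]
  ring

/-- The product W B lists the vectors x, v in the basis b. Multiplying by C replaces the first
column by the inner products with x, namely (1, 0, 0, 0, 0), and turns the others into the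
stereographic derivatives up to the factor a. The determinant of C is -1 for every x on the sphere,
so the orientation factor has constant sign. -/
theorem det_stereo {x : E5} (hx : ‖x‖ = 1) (hb : inner ℝ (b 0) x ≠ (1 : ℝ)) (v : Fin 4 → E5)
    (hv : ∀ j, inner ℝ x (v j) = (0 : ℝ)) :
    Matrix.det (Matrix.of fun i j : Fin 4 => coord i (fderiv ℝ (rayStereo b) x (v j))) =
      -(((1 - inner ℝ (b 0) x)⁻¹) ^ 4 * Matrix.det (Matrix.of fun i j : Fin 5 => b j i)) *
        Matrix.det (Matrix.of fun i j : Fin 5 => (Matrix.vecCons x v : Fin 5 → E5) i j) := by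
  set a := (1 - inner ℝ (b 0) x)⁻¹ with ha
  set w : Fin 5 → E5 := Matrix.vecCons x v with hw
  set C : Matrix (Fin 5) (Fin 5) ℝ := Matrix.of fun i j : Fin 5 => if j = 0 then inner ℝ (b i) x else
      (if i = j then 1 else 0) + if i = 0 then a * inner ℝ (b j) x else 0 with hC
  set B : Matrix (Fin 5) (Fin 5) ℝ := Matrix.of fun i j : Fin 5 => b j i with hB
  set W : Matrix (Fin 5) (Fin 5) ℝ := Matrix.of fun i j : Fin 5 => w i j with hW
  have hα : 1 - inner ℝ (b 0) x ≠ 0 := sub_ne_zero.2 (Ne.symm hb)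
  have hWB : ∀ i j, (W * B) i j = inner ℝ (b j) (w i) := by
    intro i j
    rw [PiLp.inner_apply]
    simp [Matrix.mul_apply, hW, hB]
  have hdetC : C.det = -1 := by
    rw [hC, det_arrow (fun i => inner ℝ (b i) x) a]
    have h1 := norm_sq_eq_coords b x
    rw [hx, Fin.sum_univ_four] at h1
    simp only [coord_hyperplaneProj] at h1
    have h2 : inner ℝ (b 1) x ^ 2 + inner ℝ (b 2) x ^ 2 + inner ℝ (b 3) x ^ 2 + inner ℝ (b 4) x ^ 2
        = (1 - inner ℝ (b 0) x) * (1 + inner ℝ (b 0) x) := by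
      simp only [Fin.succ_zero_eq_one, Fin.succ_one_eq_two] at h1
      have e3 : (2 : Fin 4).succ = 3 := rfl
      have e4 : (3 : Fin 4).succ = 4 := rfl
      rw [e3, e4] at h1
      linear_combination -h1
    rw [h2, ha, ← mul_assoc, inv_mul_cancel₀ hα]
    ring
  have hcol0 : ∀ i, (W * B * C) i 0 = inner ℝ x (w i) := by
    intro i
    rw [Matrix.mul_apply, ← b.sum_inner_mul_inner x (w i)]
    refine Finset.sum_congr rfl fun j _ => ?_
    rw [hWB, hC]
    simp [real_inner_comm, mul_comm]
  have hcol : ∀ i (k : Fin 4), (W * B * C) i k.succ =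
      inner ℝ (b k.succ) (w i) + a * inner ℝ (b 0) (w i) * inner ℝ (b k.succ) x := by
    intro i k
    rw [Matrix.mul_apply]
    simp only [hWB, hC, Matrix.of_apply, Fin.succ_ne_zero, if_false, mul_add, Finset.sum_add_distrib,
      mul_ite, mul_zero, mul_one, Finset.sum_ite_eq', Finset.mem_univ, if_true]
    ring
  have hdet : (W * B * C).det = Matrix.det (Matrix.of fun i k : Fin 4 =>
      inner ℝ (b k.succ) (v i) + a * inner ℝ (b 0) (v i) * inner ℝ (b k.succ) x) := by
    rw [Matrix.det_succ_column_zero, Fin.sum_univ_succ]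
    have h0 : (W * B * C) 0 0 = 1 := by
      rw [hcol0]; simp [hw, hx]
    have hs : ∀ i : Fin 4, (W * B * C) i.succ 0 = 0 := by
      intro i; rw [hcol0]; simp [hw, hv]
    simp only [hs, h0]
    simp only [mul_zero, zero_mul, Finset.sum_const_zero, add_zero, Fin.val_zero, pow_zero, one_mul]
    congr 1
    ext i k
    simp only [Matrix.submatrix_apply, Fin.succAbove_zero, hcol, Matrix.of_apply]
    simp [hw]
  have hfin : Matrix.det (Matrix.of fun i j : Fin 4 => coord i (fderiv ℝ (rayStereo b) x (v j))) =
      a ^ 4 * (W * B * C).det := by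
    rw [hdet, ← Matrix.det_transpose]
    have e : (Matrix.of fun i j : Fin 4 => coord i (fderiv ℝ (rayStereo b) x (v j))).transpose =
        a • (Matrix.of fun i k : Fin 4 =>
          inner ℝ (b k.succ) (v i) + a * inner ℝ (b 0) (v i) * inner ℝ (b k.succ) x) := by
      ext i k
      simp only [Matrix.transpose_apply, Matrix.of_apply, Matrix.smul_apply, smul_eq_mul,
        fderiv_rayStereo b hx hb (hv i)]
      rfl
    rw [e, Matrix.det_smul]
    simp
  rw [hfin, Matrix.det_mul, Matrix.det_mul, hdetC]
  ring

end Stereographic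

/-! ### Immersed surfaces in the sphere -/

theorem contMDiff_coe_S4 (m : WithTop ℕ∞) : ContMDiff (𝓡 4) 𝓘(ℝ, E5) m ((↑) : S4 → E5) :=
  @contMDiff_coe_sphere E5 _ _ m 4 ⟨finrank_euclideanSpace_fin⟩

theorem injective_mfderiv_coe_S4 (v : S4) :
    Function.Injective (mfderiv (𝓡 4) 𝓘(ℝ, E5) ((↑) : S4 → E5) v) :=
  @injective_mvfderiv_subtypeVal_sphere E5 _ _ 4 ⟨finrank_euclideanSpace_fin⟩ v

section Immersion

variable {M : Type*} [TopologicalSpace M] [ChartedSpace Plane M]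

theorem mdifferentiable_of_mem_maximalAtlas [IsManifold (𝓡 2) ∞ M]
    {c : OpenPartialHomeomorph M Plane}
    (hc : c ∈ IsManifold.maximalAtlas (𝓡 2) ∞ M) : c.MDifferentiable (𝓡 2) (𝓡 2) :=
  ⟨(contMDiffOn_of_mem_maximalAtlas hc).mdifferentiableOn (by simp),
    (contMDiffOn_symm_of_mem_maximalAtlas hc).mdifferentiableOn (by simp)⟩

/-- The derivative of the inverse of a chart relates derivatives in the chart to derivatives
on the manifold. -/
theorem exists_equiv_fderiv_comp_chart_symm [IsManifold (𝓡 2) ∞ M]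
    {c : OpenPartialHomeomorph M Plane} (hc : c ∈ IsManifold.maximalAtlas (𝓡 2) ∞ M) {p : M}
    (hp : p ∈ c.source) : ∃ A : Plane ≃L[ℝ] Plane, ∀ g : M → E5,
      ContMDiff (𝓡 2) 𝓘(ℝ, E5) ∞ g → ∀ u : Plane,
        fderiv ℝ (g ∘ c.symm) (c p) u = ambientDeriv g p (A u) := by
  have hm := mdifferentiable_of_mem_maximalAtlas hc
  refine ⟨(hm.mfderiv hp).symm, fun g hg u => ?_⟩
  have h1 : MDifferentiableAt (𝓡 2) 𝓘(ℝ, E5) g (c.symm (c p)) :=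
    hg.mdifferentiableAt (by simp)
  have h2 := mfderiv_comp (c p) h1 (hm.mdifferentiableAt_symm (c.map_source hp))
  rw [mfderiv_eq_fderiv] at h2
  rw [h2, c.left_inv hp]
  rfl

theorem range_fderiv_comp_chart_symm [IsManifold (𝓡 2) ∞ M]
    {c : OpenPartialHomeomorph M Plane} (hc : c ∈ IsManifold.maximalAtlas (𝓡 2) ∞ M) {p : M}
    (hp : p ∈ c.source) {g : M → E5} (hg : ContMDiff (𝓡 2) 𝓘(ℝ, E5) ∞ g) :
    (fderiv ℝ (g ∘ c.symm) (c p)).range = (ambientDeriv g p).range := by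
  obtain ⟨A, hA⟩ := exists_equiv_fderiv_comp_chart_symm hc hp
  ext y
  constructor
  · rintro ⟨u, rfl⟩
    exact ⟨A u, (hA g hg u).symm⟩
  · rintro ⟨u, rfl⟩
    obtain ⟨w, rfl⟩ := A.surjective u
    exact ⟨w, hA g hg w⟩

theorem injective_fderiv_comp_chart_symm [IsManifold (𝓡 2) ∞ M]
    {c : OpenPartialHomeomorph M Plane} (hc : c ∈ IsManifold.maximalAtlas (𝓡 2) ∞ M) {p : M}
    (hp : p ∈ c.source) {g : M → E5} (hg : ContMDiff (𝓡 2) 𝓘(ℝ, E5) ∞ g)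
    (hi : Function.Injective (ambientDeriv g p)) :
    Function.Injective (fderiv ℝ (g ∘ c.symm) (c p)) := by
  obtain ⟨A, hA⟩ := exists_equiv_fderiv_comp_chart_symm hc hp
  intro u w h
  rw [hA g hg, hA g hg] at h
  exact A.injective (hi h)

theorem contMDiff_coe_comp {f : M → S4} (hf : Manifold.IsSmoothEmbedding (𝓡 2) (𝓡 4) ∞ f) :
    ContMDiff (𝓡 2) 𝓘(ℝ, E5) ∞ (fun q => (f q : E5)) :=
  (contMDiff_coe_S4 ∞).comp hf.contMDiff

/-- In suitable charts an immersion is the linear injection u ↦ (u, 0) followed by an isomorphism,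
and the charts have invertible derivatives. -/
theorem injective_mfderiv_of_isImmersionAt [IsManifold (𝓡 2) ∞ M] {f : M → S4} {p : M}
    (h : Manifold.IsImmersionAt (𝓡 2) (𝓡 4) ∞ f p) :
    Function.Injective (mfderiv (𝓡 2) (𝓡 4) f p) := by
  have hφ := mdifferentiable_of_mem_maximalAtlas h.domChart_mem_maximalAtlas
  have hψ : MDifferentiableAt (𝓡 4) (𝓡 4) h.codChart (f p) :=
    (contMDiffAt_of_mem_maximalAtlas h.codChart_mem_maximalAtlas
      h.mem_codChart_source).mdifferentiableAt (by simp)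
  have hfd : MDifferentiableAt (𝓡 2) (𝓡 4) f p := h.contMDiffAt.mdifferentiableAt (by simp)
  set L : Plane →L[ℝ] EuclideanSpace ℝ (Fin 4) :=
    (h.equiv : (Plane × h.complement) →L[ℝ] EuclideanSpace ℝ (Fin 4)).comp
      (ContinuousLinearMap.inl ℝ Plane h.complement) with hL
  have hLi : Function.Injective L := by
    intro u w huw
    have := h.equiv.injective huw
    exact (Prod.ext_iff.1 this).1
  have heq : h.codChart ∘ f =ᶠ[𝓝 p] L ∘ h.domChart := by
    filter_upwards [h.domChart.open_source.mem_nhds h.mem_domChart_source] with q hq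
    have hq' : h.domChart q ∈ (h.domChart.extend (𝓡 2)).target := by
      simpa using h.domChart.map_source hq
    have h1 := h.writtenInCharts hq'
    simpa [hL, h.domChart.left_inv hq] using h1
  have h1 := mfderiv_comp p hψ hfd
  have h2 : mfderiv (𝓡 2) (𝓡 4) (L ∘ h.domChart) p =
      L.comp (mfderiv (𝓡 2) (𝓡 2) h.domChart p) := by
    rw [mfderiv_comp p ((L.contMDiff (n := 1)).mdifferentiableAt (by simp))
      (hφ.mdifferentiableAt h.mem_domChart_source)]
    rw [ContinuousLinearMap.mfderiv_eq]
    rfl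
  intro u w huw
  apply hφ.mfderiv_injective h.mem_domChart_source
  apply hLi
  have h3 := heq.mfderiv_eq (I := 𝓡 2) (I' := 𝓡 4)
  rw [h1, h2] at h3
  have hu := congrArg (fun T => T u) h3
  have hw := congrArg (fun T => T w) h3
  exact hu.symm.trans ((congrArg _ huw).trans hw)

theorem injective_ambientDeriv [IsManifold (𝓡 2) ∞ M] {f : M → S4}
    (hf : Manifold.IsSmoothEmbedding (𝓡 2) (𝓡 4) ∞ f) (p : M) :
    Function.Injective (ambientDeriv (fun q => (f q : E5)) p) := by
  have h1 : mfderiv (𝓡 2) 𝓘(ℝ, E5) (fun q => (f q : E5)) p =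
      (mfderiv (𝓡 4) 𝓘(ℝ, E5) ((↑) : S4 → E5) (f p)).comp (mfderiv (𝓡 2) (𝓡 4) f p) :=
    mfderiv_comp p ((contMDiff_coe_S4 1).mdifferentiableAt (by simp))
      (hf.contMDiff.mdifferentiableAt (by simp))
  rw [ambientDeriv, h1]
  exact (injective_mfderiv_coe_S4 (f p)).comp (injective_mfderiv_of_isImmersionAt (hf.isImmersion.isImmersionAt p))

/-- An immersed surface meets its own normal spaces only at the base point, locally. -/
theorem exists_nhds_eq_of_orthogonal [IsManifold (𝓡 2) ∞ M] {g : M → E5}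
    (hg : ContMDiff (𝓡 2) 𝓘(ℝ, E5) ∞ g) {x : M} (hi : Function.Injective (ambientDeriv g x)) :
    ∃ U : Set M, IsOpen U ∧ x ∈ U ∧ ∀ p ∈ U, ∀ q ∈ U,
      (∀ u, inner ℝ (g p - g q) (ambientDeriv g q u) = (0 : ℝ)) → p = q := by
  set c := chartAt Plane x with hcdef
  have hc : c ∈ IsManifold.maximalAtlas (𝓡 2) ∞ M := IsManifold.chart_mem_maximalAtlas x
  have hx : x ∈ c.source := mem_chart_source Plane x
  set h := g ∘ c.symm with hh
  have hinj := injective_fderiv_comp_chart_symm hc hx hg hi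
  set T := fderiv ℝ h (c x) with hT
  obtain ⟨K, hK, hKT⟩ := (T : Plane →ₗ[ℝ] E5).exists_antilipschitzWith
    (LinearMap.ker_eq_bot.2 hinj)
  have hcd := contDiffAt_comp_chart_symm hc hg (c.map_source hx)
  have hstr : HasStrictFDerivAt h T (c x) := hcd.hasStrictFDerivAt (by simp)
  have hK' : (0 : ℝ) < K := hK
  have hTu : ∀ u : Plane, ‖u‖ ≤ K * ‖T u‖ := fun u => by
    have := hKT.le_mul_dist u 0
    simpa using this
  -- The constant 1/(4K) makes both error terms below at most ‖T u‖ / 4, since ‖u‖ ≤ K ‖T u‖.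
  have e1 : ∀ᶠ v : Plane × Plane in 𝓝 (c x, c x),
      ‖h v.1 - h v.2 - T (v.1 - v.2)‖ ≤ (4 * K : ℝ)⁻¹ * ‖v.1 - v.2‖ :=
    (hstr.isLittleO.bound (inv_pos.2 (by positivity)))
  have hfd : ContinuousAt (fderiv ℝ h) (c x) :=
    (continuousOn_fderiv_comp_chart_symm hc hg).continuousAt
      (c.open_target.mem_nhds (c.map_source hx))
  have e2 : ∀ᶠ z in 𝓝 (c x), ‖fderiv ℝ h z - T‖ < (4 * K : ℝ)⁻¹ := by
    have := hfd.sub_const T |>.norm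
    refine this.eventually_lt_const ?_
    rw [hT, sub_self, norm_zero]
    positivity
  rw [nhds_prod_eq] at e1
  obtain ⟨V, hV, hVV⟩ := eventually_prod_self_iff'.1 e1
  have hnhds : c.source ∩ c ⁻¹' (V ∩ {z | ‖fderiv ℝ h z - T‖ < (4 * K : ℝ)⁻¹}) ∈ 𝓝 x :=
    inter_mem (c.open_source.mem_nhds hx) ((c.continuousAt hx) (inter_mem hV e2))
  obtain ⟨U, hU, hUo, hxU⟩ := mem_nhds_iff.1 hnhds
  refine ⟨U, hUo, hxU, fun p hp q hq horth => ?_⟩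
  obtain ⟨hps, hpV, -⟩ := hU hp
  obtain ⟨hqs, hqV, hq2⟩ := hU hq
  have f1 := hVV (c p) hpV (c q) hqV
  simp only at f1
  have f2 : ‖fderiv ℝ h (c q) - T‖ < (4 * K : ℝ)⁻¹ := hq2
  obtain ⟨A, hA⟩ := exists_equiv_fderiv_comp_chart_symm hc hqs
  set u := c p - c q with hu
  have h3 := horth (A u)
  rw [← hA g hg u] at h3
  have hgp : h (c p) = g p := by simp [hh, c.left_inv hps]
  have hgq : h (c q) = g q := by simp [hh, c.left_inv hqs]
  rw [hgp, hgq] at f1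
  set r₁ := g p - g q - T u with hr₁
  set r₂ := fderiv ℝ h (c q) u - T u with hr₂
  have hr₂n : ‖r₂‖ ≤ (4 * K : ℝ)⁻¹ * ‖u‖ := by
    have := (fderiv ℝ h (c q) - T).le_of_opNorm_le f2.le u
    simpa using this
  have e3 : g p - g q = T u + r₁ := by rw [hr₁]; abel
  have e4 : fderiv ℝ (g ∘ c.symm) (c q) u = T u + r₂ := by rw [hr₂]; abel
  rw [e3, e4, inner_add_left, inner_add_right, inner_add_right, real_inner_self_eq_norm_sq] at h3
  have b1 := abs_le.1 (abs_real_inner_le_norm (T u) r₂)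
  have b2 := abs_le.1 (abs_real_inner_le_norm r₁ (T u))
  have b3 := abs_le.1 (abs_real_inner_le_norm r₁ r₂)
  have hm := hTu u
  have hk : (4 * K : ℝ)⁻¹ * ‖u‖ ≤ ‖T u‖ / 4 := by
    rw [inv_mul_le_iff₀ (by positivity)]; linarith
  have g1 : ‖r₁‖ ≤ ‖T u‖ / 4 := f1.trans hk
  have g2 : ‖r₂‖ ≤ ‖T u‖ / 4 := hr₂n.trans hk
  have hm0 := norm_nonneg (T u)
  have p1 : ‖T u‖ * ‖r₂‖ ≤ ‖T u‖ * (‖T u‖ / 4) := by gcongr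
  have p2 : ‖r₁‖ * ‖T u‖ ≤ ‖T u‖ / 4 * ‖T u‖ := by gcongr
  have p3 : ‖r₁‖ * ‖r₂‖ ≤ ‖T u‖ / 4 * (‖T u‖ / 4) := by gcongr
  -- The orthogonality reads ⟨T u + r₁, T u + r₂⟩ = 0, whereas the left side is at least (1 - 1/4 -
  -- 1/4 - 1/16) ‖T u‖².
  have hz : ‖T u‖ = 0 := by nlinarith
  have hu0 : u = 0 := by
    rw [hz, mul_zero] at hm
    exact norm_le_zero_iff.1 hm
  exact c.injOn hps hqs (sub_eq_zero.1 hu0)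

/-- The local statement covers a neighbourhood of the diagonal; on its compact complement
injectivity of g bounds ‖g p - g q‖ below. -/
theorem exists_pos_eq_of_orthogonal [CompactSpace M] [IsManifold (𝓡 2) ∞ M] {g : M → E5}
    (hg : ContMDiff (𝓡 2) 𝓘(ℝ, E5) ∞ g) (hi : ∀ x, Function.Injective (ambientDeriv g x))
    (hinj : Function.Injective g) :
    ∃ δ > 0, ∀ p q, ‖g p - g q‖ < δ →
      (∀ u, inner ℝ (g p - g q) (ambientDeriv g q u) = (0 : ℝ)) → p = q := by
  choose U hUo hxU hU using fun x => exists_nhds_eq_of_orthogonal hg (hi x)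
  have hQ : IsCompact (⋃ x, U x ×ˢ U x)ᶜ :=
    (isOpen_iUnion fun x => (hUo x).prod (hUo x)).isClosed_compl.isCompact
  obtain ⟨δ, hδ, hfar⟩ := hQ.exists_forall_le' (f := fun x : M × M => ‖g x.1 - g x.2‖) (a := 0)
    ((hg.continuous.comp continuous_fst).sub (hg.continuous.comp continuous_snd)).norm.continuousOn
    (by
      rintro ⟨p, q⟩ hpq
      rw [norm_pos_iff, sub_ne_zero]
      intro h
      obtain rfl : p = q := hinj h
      exact hpq (mem_iUnion.2 ⟨p, hxU p, hxU p⟩))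
  refine ⟨δ, hδ, fun p q hpq horth => ?_⟩
  have hmem : (p, q) ∈ ⋃ x, U x ×ˢ U x := by
    by_contra h
    exact hpq.not_ge (hfar (p, q) (mem_compl h))
  obtain ⟨x, hpx, hqx⟩ := mem_iUnion.1 hmem
  exact hU x p hpx q hqx horth

theorem exists_finset_chart_cover [CompactSpace M] :
    ∃ t : Finset M, ∀ p : M, ∃ x ∈ t, p ∈ (chartAt Plane x).source := by
  obtain ⟨t, ht⟩ := isCompact_univ.elim_finite_subcover (fun x : M => (chartAt Plane x).source)
    (fun x => (chartAt Plane x).open_source)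
    (fun x _ => mem_iUnion.2 ⟨x, mem_chart_source Plane x⟩)
  refine ⟨t, fun p => ?_⟩
  simpa using ht (mem_univ p)

/-- A compact surface does not fill the unit sphere. -/
theorem exists_unit_notMem_range [CompactSpace M] [IsManifold (𝓡 2) ∞ M] {g : M → E5}
    (hg : ContMDiff (𝓡 2) 𝓘(ℝ, E5) ∞ g) : ∃ v : E5, ‖v‖ = 1 ∧ ∀ p, g p ≠ v := by
  obtain ⟨t, ht⟩ := exists_finset_chart_cover (M := M)
  -- The cone over the surface is a finite union of locally Lipschitz images of three-dimensional
  -- sets, so its Hausdorff dimension is at most 3 < 5. Any nonzero vector off the cone, once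
  -- normalized, is missed by g.
  set Φ : M → ℝ × Plane → E5 := fun x v => v.1 • (g ∘ (chartAt Plane x).symm) v.2 with hΦ
  set S : Set E5 := ⋃ x ∈ (t : Set M), Φ x '' (univ ×ˢ (chartAt Plane x).target) with hS
  have hdim : ∀ x, dimH (Φ x '' (univ ×ˢ (chartAt Plane x).target)) ≤ 3 := by
    intro x
    have h1 : dimH (Φ x '' (univ ×ˢ (chartAt Plane x).target)) ≤
        dimH (univ ×ˢ (chartAt Plane x).target : Set (ℝ × Plane)) := by
      refine dimH_image_le_of_locally_lipschitzOn fun v hv => ?_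
      have hcd : ContDiffAt ℝ 1 (Φ x) v := by
        refine contDiffAt_fst.smul ?_
        have := (contDiffAt_comp_chart_symm (IsManifold.chart_mem_maximalAtlas x) hg hv.2).of_le
          (m := 1) (by simp)
        exact this.comp v contDiffAt_snd
      obtain ⟨C, u, hu, hL⟩ := hcd.exists_lipschitzOnWith
      exact ⟨C, u, mem_nhdsWithin_of_mem_nhds hu, hL⟩
    refine h1.trans ((dimH_mono (subset_univ _)).trans ?_)
    rw [Real.dimH_univ_eq_finrank]
    simp
  have hSd : Dense Sᶜ := by
    apply dense_compl_of_dimH_lt_finrank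
    rw [hS, dimH_bUnion t.countable_toSet]
    refine (iSup₂_le fun x _ => hdim x).trans_lt ?_
    simp
    norm_num
  obtain ⟨v, hvS, hv0⟩ := hSd.exists_mem_open isOpen_compl_singleton
    (⟨EuclideanSpace.single 0 1, by simp⟩ : ({0}ᶜ : Set E5).Nonempty)
  refine ⟨‖v‖⁻¹ • v, by simp [norm_smul, inv_mul_cancel₀ (norm_ne_zero_iff.2 hv0)], fun p hp => ?_⟩
  obtain ⟨x, hx, hpx⟩ := ht p
  apply hvS
  refine mem_biUnion (Finset.mem_coe.2 hx) ⟨(‖v‖, chartAt Plane x p),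
    ⟨mem_univ _, (chartAt Plane x).map_source hpx⟩, ?_⟩
  simp [hΦ, (chartAt Plane x).left_inv hpx, hp, smul_smul, mul_inv_cancel₀ (norm_ne_zero_iff.2 hv0)]

end Immersion

/-! ### Determinants at a zero -/

/-- Adding the first two columns to the last two leaves -ε b₀ and -ε b₁, whose signs cancel. -/
theorem det_four_columns (a₀ a₁ b₀ b₁ : Fin 4 → ℝ) (ε : ℝ) :
    Matrix.det (Matrix.of fun i j : Fin 4 =>
      ![a₀ i, a₁ i, -(a₀ i + ε * b₀ i), -(a₁ i + ε * b₁ i)] j) =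
    ε ^ 2 * Matrix.det (Matrix.of fun i j : Fin 4 => ![a₀ i, a₁ i, b₀ i, b₁ i] j) := by
  rw [Matrix.det_succ_row_zero, Matrix.det_succ_row_zero]
  simp only [Fin.sum_univ_four, Matrix.det_fin_three, Matrix.submatrix_apply, Matrix.of_apply]
  simp [Fin.succAbove, Fin.lt_def]
  ring

theorem det_two_blocks (p q r t : ℝ) : Matrix.det !![1, 0, 0, 0, 0; 0, p, q, 0, 0; 0, r, t, 0, 0;
    0, 0, 0, p, q; 0, 0, 0, r, t] = (p * t - r * q) ^ 2 := by
  simp [Matrix.det_succ_row_zero, Fin.sum_univ_succ, Fin.succAbove]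
  ring

/-- The change of basis acts on the rows by a block matrix with blocks 1 and twice the same
two-by-two block, hence by a square. Signs computed in an oriented chart thus agree with those in
the preferred chart. -/
theorem det_change_of_basis (x : E5) (S T : Plane →L[ℝ] E5) (A : Plane →L[ℝ] Plane) :
    Matrix.det (Matrix.of fun i j : Fin 5 => (![x, S (A (planeVec 0)), S (A (planeVec 1)),
      T (A (planeVec 0)), T (A (planeVec 1))] : Fin 5 → E5) i j) =
    A.det ^ 2 * Matrix.det (Matrix.of fun i j : Fin 5 => (![x, S (planeVec 0), S (planeVec 1),
      T (planeVec 0), T (planeVec 1)] : Fin 5 → E5) i j) := by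
  have h : ∀ (R : Plane →L[ℝ] E5) (i : Fin 2) (j : Fin 5), R (A (planeVec i)) j =
      A (planeVec i) 0 * R (planeVec 0) j + A (planeVec i) 1 * R (planeVec 1) j := by
    intro R i j
    conv_lhs => rw [plane_eq_sum (A (planeVec i))]
    simp
  rw [det_plane, ← det_two_blocks, ← Matrix.det_mul]
  congr 1
  ext i j
  fin_cases i <;> simp [Matrix.mul_apply, Fin.sum_univ_succ, h]

/-! ### Transverse normal sections: isolated, nondegenerate zeros -/

section NormalSection

variable {M : Type*} [TopologicalSpace M] [ChartedSpace Plane M] {f : M → S4}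

theorem mem_normalSpace_iff {p : M} {n : E5} : n ∈ normalSpace f p ↔
    inner ℝ (f p : E5) n = (0 : ℝ) ∧
      ∀ u, inner ℝ (ambientDeriv (fun q => (f q : E5)) p u) n = (0 : ℝ) := by
  rw [normalSpace, ← Submodule.inf_orthogonal, Submodule.mem_inf,
    Submodule.mem_orthogonal_singleton_iff_inner_right, Submodule.mem_orthogonal]
  simp

/-- Differentiate ‖f‖² = 1. -/
theorem inner_ambientDeriv_eq_zero (hf : ContMDiff (𝓡 2) 𝓘(ℝ, E5) ∞ (fun q => (f q : E5)))
    [IsManifold (𝓡 2) ∞ M] (p : M) (u : TangentSpace (𝓡 2) p) :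
    inner ℝ (f p : E5) (ambientDeriv (fun q => (f q : E5)) p u) = (0 : ℝ) := by
  set c := chartAt Plane p
  have hp : p ∈ c.source := mem_chart_source Plane p
  obtain ⟨A, hA⟩ := exists_equiv_fderiv_comp_chart_symm
    (IsManifold.chart_mem_maximalAtlas (I := 𝓡 2) (n := ∞) p) hp
  obtain ⟨w, rfl⟩ := A.surjective u
  rw [← hA _ hf w]
  set h := (fun q => (f q : E5)) ∘ c.symm with hh
  have hd : HasFDerivAt h (fderiv ℝ h (c p)) (c p) :=
    ((contDiffAt_comp_chart_symm (IsManifold.chart_mem_maximalAtlas (I := 𝓡 2) (n := ∞) p) hf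
      (c.map_source hp)).differentiableAt (by simp)).hasFDerivAt
  have h1 := hd.norm_sq
  have h2 : (fun z => ‖h z‖ ^ 2) = fun _ => (1 : ℝ) := by
    ext z; simp [hh]
  rw [h2] at h1
  have h3 := congrArg (fun l : Plane →L[ℝ] ℝ => l w) (h1.unique (hasFDerivAt_const 1 (c p)))
  have h4 : h (c p) = f p := by simp [hh, c.left_inv hp]
  rw [← h4]
  simpa using h3

theorem finiteDimensional_tangentSpace (p : M) :
    FiniteDimensional ℝ (TangentSpace (𝓡 2) p) :=
  inferInstanceAs (FiniteDimensional ℝ Plane)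

/-- The count is 5 - (1 + 2). This lower bound suffices: a transverse ds maps a plane onto a space
of dimension at least 2, so it is injective. -/
theorem two_le_finrank_normalSpace (p : M) : 2 ≤ Module.finrank ℝ (normalSpace f p) := by
  have := finiteDimensional_tangentSpace p
  set T := (ambientDeriv (fun q => (f q : E5)) p).range
  set S := Submodule.span ℝ {(f p : E5)}
  have h1 := (S ⊔ T).finrank_add_finrank_orthogonal
  have h2 := Submodule.finrank_add_le_finrank_add_finrank S T
  have h3 : Module.finrank ℝ S ≤ 1 :=
    (finrank_span_le_card {(f p : E5)}).trans (by simp)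
  have h4 : Module.finrank ℝ T ≤ 2 := by
    have := LinearMap.finrank_range_le
      (ambientDeriv (fun q => (f q : E5)) p : TangentSpace (𝓡 2) p →ₗ[ℝ] E5)
    refine this.trans (le_of_eq ?_)
    exact finrank_euclideanSpace_fin (𝕜 := ℝ) (n := 2)
  have h5 : Module.finrank ℝ E5 = 5 := finrank_euclideanSpace_fin
  change 2 ≤ Module.finrank ℝ (S ⊔ T)ᗮ
  omega

theorem IsTransverseNormalSection.injective_ambientDeriv {s : M → E5}
    (hs : IsTransverseNormalSection f s) {p : M} (hp : s p = 0) :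
    Function.Injective (ambientDeriv s p) := by
  have := finiteDimensional_tangentSpace p
  have h1 := LinearMap.finrank_range_add_finrank_ker
    (ambientDeriv s p : TangentSpace (𝓡 2) p →ₗ[ℝ] E5)
  have h2 : Module.finrank ℝ (TangentSpace (𝓡 2) p) = 2 :=
    finrank_euclideanSpace_fin (𝕜 := ℝ) (n := 2)
  have h3 := two_le_finrank_normalSpace (f := f) p
  rw [← hs.transverse p hp] at h3
  have h4 : Module.finrank ℝ (LinearMap.ker
      (ambientDeriv s p : TangentSpace (𝓡 2) p →ₗ[ℝ] E5)) = 0 := by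
    rw [h2] at h1
    change 2 ≤ Module.finrank ℝ (LinearMap.range
      (ambientDeriv s p : TangentSpace (𝓡 2) p →ₗ[ℝ] E5)) at h3
    omega
  exact LinearMap.ker_eq_bot.1 (Submodule.finrank_eq_zero.1 h4)

theorem IsTransverseNormalSection.eventually_ne_zero [IsManifold (𝓡 2) ∞ M] {s : M → E5}
    (hs : IsTransverseNormalSection f s) {p : M} (hp : s p = 0) :
    ∀ᶠ q in 𝓝[≠] p, s q ≠ 0 := by
  set c := chartAt Plane p
  have hpc : p ∈ c.source := mem_chart_source Plane p
  have hc := IsManifold.chart_mem_maximalAtlas (I := 𝓡 2) (n := ∞) p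
  have hinj := injective_fderiv_comp_chart_symm hc hpc hs.smooth (hs.injective_ambientDeriv hp)
  have hd : HasFDerivAt (s ∘ c.symm) (fderiv ℝ (s ∘ c.symm) (c p)) (c p) :=
    ((contDiffAt_comp_chart_symm hc hs.smooth
      (c.map_source hpc)).differentiableAt (by simp)).hasFDerivAt
  obtain ⟨K, hK, hKT⟩ := (fderiv ℝ (s ∘ c.symm) (c p) : Plane →ₗ[ℝ] E5).exists_antilipschitzWith
    (LinearMap.ker_eq_bot.2 hinj)
  have h1 := hd.eventually_ne (c := 0) ⟨K, hKT⟩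
  rw [eventually_nhdsWithin_iff] at h1 ⊢
  filter_upwards [(c.continuousAt hpc).eventually h1, c.open_source.mem_nhds hpc] with q hq hqs hqp
  have h2 := hq fun h => hqp (c.injOn hqs hpc h)
  simpa [c.left_inv hqs] using h2

theorem IsTransverseNormalSection.finite_zeros [IsManifold (𝓡 2) ∞ M] [CompactSpace M]
    {s : M → E5} (hs : IsTransverseNormalSection f s) : {p | s p = 0}.Finite := by
  by_contra hinf
  have hclosed : IsClosed {p | s p = 0} := isClosed_eq hs.smooth.continuous continuous_const
  obtain ⟨p, hp, hacc⟩ := Set.Infinite.exists_accPt_of_subset_isCompact hinf hclosed.isCompact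
    subset_rfl
  exact (accPt_iff_frequently_nhdsNE.1 hacc) (by
    filter_upwards [hs.eventually_ne_zero hp] with q hq h using hq h)

/-- The position vector, the tangent plane and the normal space are mutually orthogonal, and df and
ds are injective, so the five rows are independent. -/
theorem IsTransverseNormalSection.det_ne_zero [IsManifold (𝓡 2) ∞ M]
    (hf : ContMDiff (𝓡 2) 𝓘(ℝ, E5) ∞ (fun q => (f q : E5)))
    (hi : ∀ p, Function.Injective (ambientDeriv (fun q => (f q : E5)) p)) {s : M → E5}
    (hs : IsTransverseNormalSection f s) {p : M} (hp : s p = 0) :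
    Matrix.det (Matrix.of fun i j : Fin 5 => (![(f p : E5),
      ambientDeriv (fun q => (f q : E5)) p (planeVec 0),
      ambientDeriv (fun q => (f q : E5)) p (planeVec 1),
      ambientDeriv s p (planeVec 0), ambientDeriv s p (planeVec 1)] : Fin 5 → E5) i j) ≠ 0 := by
  have hS : ∀ u, ambientDeriv s p u ∈ normalSpace f p := fun u => by
    rw [← hs.transverse p hp]; exact ⟨u, rfl⟩
  have hsinj := hs.injective_ambientDeriv hp
  set w : Fin 5 → E5 := ![(f p : E5),
      ambientDeriv (fun q => (f q : E5)) p (planeVec 0),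
      ambientDeriv (fun q => (f q : E5)) p (planeVec 1),
      ambientDeriv s p (planeVec 0), ambientDeriv s p (planeVec 1)] with hw
  set S : Plane →L[ℝ] E5 := ambientDeriv s p with hSdef
  set T : Plane →L[ℝ] E5 := ambientDeriv (fun q => (f q : E5)) p with hTdef
  have hli : LinearIndependent ℝ w := by
    rw [Fintype.linearIndependent_iff]
    intro a ha
    set t : Plane := a 1 • planeVec 0 + a 2 • planeVec 1 with ht
    set n : Plane := a 3 • planeVec 0 + a 4 • planeVec 1 with hn
    have h0 : a 0 • (f p : E5) + T t + S n = 0 := by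
      refine Eq.trans ?_ ha
      simp only [Fin.sum_univ_five, hw, ht, hn, map_add, map_smul]
      simp [add_assoc]
      rfl
    have hxS : inner ℝ (f p : E5) (S n) = (0 : ℝ) := (mem_normalSpace_iff.1 (hS n)).1
    have hTS : inner ℝ (T t) (S n) = (0 : ℝ) := (mem_normalSpace_iff.1 (hS n)).2 t
    have hxT : inner ℝ (f p : E5) (T t) = (0 : ℝ) := inner_ambientDeriv_eq_zero hf p t
    have hxx : inner ℝ (f p : E5) (f p : E5) = (1 : ℝ) := by
      rw [real_inner_self_eq_norm_sq]; simp
    have hSn : S n = 0 := by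
      have h := congrArg (fun y => inner ℝ y (S n)) h0
      simp only [inner_add_left, inner_smul_left, hxS, hTS, inner_zero_left] at h
      simpa using h
    have ha0 : a 0 = 0 := by
      have h := congrArg (fun y => inner ℝ (f p : E5) y) h0
      simp only [inner_add_right, inner_smul_right, hxS, hxT, hxx, inner_zero_right] at h
      simpa using h
    have hTt : T t = 0 := by simpa [ha0, hSn] using h0
    have ht0 : t = 0 := hi p (hTt.trans (map_zero T).symm)
    have hn0 : n = 0 := hsinj (hSn.trans (map_zero S).symm)
    have t0 := congrArg (fun v : Plane => v 0) ht0
    have t1 := congrArg (fun v : Plane => v 1) ht0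
    have n0 := congrArg (fun v : Plane => v 0) hn0
    have n1 := congrArg (fun v : Plane => v 1) hn0
    simp [ht, planeVec] at t0 t1
    simp [hn, planeVec] at n0 n1
    intro i
    fin_cases i <;> assumption
  have hli' : LinearIndependent ℝ (Matrix.of fun i j : Fin 5 => w i j).row := by
    have := hli.map' (WithLp.linearEquiv 2 ℝ (Fin 5 → ℝ)).toLinearMap (LinearEquiv.ker _)
    exact this
  exact ((Matrix.isUnit_iff_isUnit_det _).1 (Matrix.linearIndependent_rows_iff_isUnit.1 hli')).ne_zero

end NormalSection

/-! ### The push-off and the signed count of zeros -/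

theorem exists_orthonormalBasis_zero_eq {v : E5} (hv : ‖v‖ = 1) :
    ∃ b : OrthonormalBasis (Fin 5) ℝ E5, b 0 = v := by
  obtain ⟨b, hb⟩ := Orthonormal.exists_orthonormalBasis_extension_of_card_eq
    (𝕜 := ℝ) (E := E5) (ι := Fin 5) (by simp) (v := fun _ => v) (s := {0}) (by
      rw [orthonormal_iff_ite]
      rintro ⟨i, hi⟩ ⟨j, hj⟩
      obtain rfl : i = 0 := hi
      obtain rfl : j = 0 := hj
      simp [hv])
  exact ⟨b, hb 0 rfl⟩

/-- The normalization of a perturbation of a unit vector by an orthogonal vector stays close. -/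
theorem norm_normalize_add_sub_le {x y : E5} (hx : ‖x‖ = 1) (hxy : inner ℝ x y = (0 : ℝ)) :
    1 ≤ ‖x + y‖ ∧ ‖‖x + y‖⁻¹ • (x + y) - x‖ ≤ 2 * ‖y‖ := by
  have h1 : 1 ≤ ‖x + y‖ := by
    have := norm_add_sq_real x y
    rw [hxy, hx] at this
    nlinarith [sq_nonneg ‖y‖, norm_nonneg (x + y)]
  refine ⟨h1, ?_⟩
  have h0 : ‖x + y‖ ≠ 0 := by positivity
  have h2 : ‖‖x + y‖⁻¹ • (x + y) - (x + y)‖ = ‖x + y‖ - 1 := by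
    have : ‖x + y‖⁻¹ • (x + y) - (x + y) = (‖x + y‖⁻¹ - 1) • (x + y) := by
      rw [sub_smul, one_smul]
    rw [this, norm_smul, Real.norm_eq_abs, abs_of_nonpos (by
      rw [sub_nonpos]; exact inv_le_one_of_one_le₀ h1)]
    field_simp
    ring
  have h3 : ‖x + y‖ ≤ 1 + ‖y‖ := (norm_add_le x y).trans (by rw [hx])
  calc ‖‖x + y‖⁻¹ • (x + y) - x‖ = ‖(‖x + y‖⁻¹ • (x + y) - (x + y)) + y‖ := by congr 1; abel
    _ ≤ ‖‖x + y‖⁻¹ • (x + y) - (x + y)‖ + ‖y‖ := norm_add_le _ _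
    _ ≤ 2 * ‖y‖ := by rw [h2]; linarith

section EulerNumber

variable {M : Type*} [TopologicalSpace M] [ChartedSpace Plane M] {f : M → S4}

/-- The orientation sign of the difference of the stereographic projections of a surface and of
its push-off along a transverse normal section, at a zero of the section. -/
theorem det_diffMap_rayStereo [IsManifold (𝓡 2) ∞ M]
    (hf : ContMDiff (𝓡 2) 𝓘(ℝ, E5) ∞ (fun q => (f q : E5))) {s : M → E5}
    (hs : IsTransverseNormalSection f s) (b : OrthonormalBasis (Fin 5) ℝ E5) {p : M}
    (hb : (f p : E5) ≠ b 0) (hp : s p = 0) {c : OpenPartialHomeomorph M Plane}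
    (hc : c ∈ IsManifold.maximalAtlas (𝓡 2) ∞ M) (hpc : p ∈ c.source) (ε : ℝ) :
    ∃ r : ℝ, 0 < r ∧ (diffMap (fderiv ℝ ((fun q => rayStereo b (f q)) ∘ c.symm) (c p))
      (fderiv ℝ ((fun q => rayStereo b (f q + ε • s q)) ∘ c.symm) (c p))).det =
      ε ^ 2 * r * (-Matrix.det (Matrix.of fun i j : Fin 5 => b j i) *
        Matrix.det (Matrix.of fun i j : Fin 5 => (![(f p : E5),
      ambientDeriv (fun q => (f q : E5)) p (planeVec 0),
      ambientDeriv (fun q => (f q : E5)) p (planeVec 1),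
      ambientDeriv s p (planeVec 0), ambientDeriv s p (planeVec 1)] : Fin 5 → E5) i j)) := by
  have hn : ‖(f p : E5)‖ = 1 := by simp
  have hb1 := inner_lt_norm_of_ne b hn hb
  have hx0 : (f p : E5) ≠ 0 := by
    intro h; rw [h] at hn; simp at hn
  obtain ⟨A, hA⟩ := exists_equiv_fderiv_comp_chart_symm hc hpc
  set g : M → E5 := fun q => (f q : E5) with hg
  set σ' := fderiv ℝ (rayStereo b) (f p : E5) with hσ'
  have hσ : HasFDerivAt (rayStereo b) σ' (f p : E5) :=
    ((contDiffAt_rayStereo b hx0 (by rw [hn]; exact hb1)).differentiableAt (by simp)).hasFDerivAt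
  have hgd : HasFDerivAt (g ∘ c.symm) (fderiv ℝ (g ∘ c.symm) (c p)) (c p) :=
    ((contDiffAt_comp_chart_symm hc hf (c.map_source hpc)).differentiableAt (by simp)).hasFDerivAt
  have hsd : HasFDerivAt (s ∘ c.symm) (fderiv ℝ (s ∘ c.symm) (c p)) (c p) :=
    ((contDiffAt_comp_chart_symm hc hs.smooth
      (c.map_source hpc)).differentiableAt (by simp)).hasFDerivAt
  have hgp : (g ∘ c.symm) (c p) = f p := by simp [hg, c.left_inv hpc]
  have hsp : (s ∘ c.symm) (c p) = 0 := by simp [hp, c.left_inv hpc]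
  have hF : fderiv ℝ ((fun q => rayStereo b (f q)) ∘ c.symm) (c p) =
      σ'.comp (fderiv ℝ (g ∘ c.symm) (c p)) := by
    rw [← hgp] at hσ
    exact (hσ.comp (c p) hgd).fderiv
  -- As s p = 0, the push-off also passes through f p, so the same derivative σ' of the projection
  -- governs both maps.
  have hG : fderiv ℝ ((fun q => rayStereo b (f q + ε • s q)) ∘ c.symm) (c p) =
      σ'.comp (fderiv ℝ (g ∘ c.symm) (c p) + ε • fderiv ℝ (s ∘ c.symm) (c p)) := by
    have h1 : HasFDerivAt (fun z => (g ∘ c.symm) z + ε • (s ∘ c.symm) z)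
        (fderiv ℝ (g ∘ c.symm) (c p) + ε • fderiv ℝ (s ∘ c.symm) (c p)) (c p) :=
      hgd.add (hsd.const_smul ε)
    have h2 : (g ∘ c.symm) (c p) + ε • (s ∘ c.symm) (c p) = f p := by rw [hgp, hsp]; simp
    rw [← h2] at hσ
    exact (HasFDerivAt.comp (c p) hσ h1).fderiv
  set S : Plane →L[ℝ] E5 := ambientDeriv s p with hS
  set T : Plane →L[ℝ] E5 := ambientDeriv g p with hT
  have hgu : ∀ u, fderiv ℝ (g ∘ c.symm) (c p) u = T (A u) := hA g hf
  have hsu : ∀ u, fderiv ℝ (s ∘ c.symm) (c p) u = S (A u) := hA s hs.smooth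
  have hxT : ∀ u, inner ℝ (f p : E5) (T u) = (0 : ℝ) := inner_ambientDeriv_eq_zero hf p
  have hxS : ∀ u, inner ℝ (f p : E5) (S u) = (0 : ℝ) := fun u => by
    have : S u ∈ normalSpace f p := by rw [← hs.transverse p hp]; exact ⟨u, rfl⟩
    exact (mem_normalSpace_iff.1 this).1
  have hmat : (Matrix.of fun i j : Fin 4 => coord i ((![σ' (T (A (planeVec 0))),
      σ' (T (A (planeVec 1))), -σ' (T (A (planeVec 0)) + ε • S (A (planeVec 0))),
      -σ' (T (A (planeVec 1)) + ε • S (A (planeVec 1)))] : Fin 4 → FourSpace) j)) =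
      Matrix.of fun i j : Fin 4 =>
      ![coord i (σ' (T (A (planeVec 0)))), coord i (σ' (T (A (planeVec 1)))),
        -(coord i (σ' (T (A (planeVec 0)))) + ε * coord i (σ' (S (A (planeVec 0))))),
        -(coord i (σ' (T (A (planeVec 1)))) + ε * coord i (σ' (S (A (planeVec 1)))))] j := by
    ext i j
    fin_cases j <;> simp
  set v : Fin 4 → E5 := ![T (A (planeVec 0)), T (A (planeVec 1)), S (A (planeVec 0)),
    S (A (planeVec 1))] with hv
  have hmat2 : (Matrix.of fun i j : Fin 4 =>
      ![coord i (σ' (T (A (planeVec 0)))), coord i (σ' (T (A (planeVec 1)))),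
        coord i (σ' (S (A (planeVec 0)))), coord i (σ' (S (A (planeVec 1))))] j) =
      Matrix.of fun i j : Fin 4 => coord i (σ' (v j)) := by
    ext i j
    fin_cases j <;> rfl
  have hdetA : (A : Plane →L[ℝ] Plane).det ≠ 0 := (A.toLinearEquiv.isUnit_det').ne_zero
  -- This is the witness r: the conformal factor of `det_stereo` times the square from the change of
  -- basis.
  have hpos : 0 < (1 - inner ℝ (b 0) (f p : E5))⁻¹ ^ 4 * (A : Plane →L[ℝ] Plane).det ^ 2 := by
    have : 1 - inner ℝ (b 0) (f p : E5) ≠ 0 := sub_ne_zero.2 (Ne.symm hb1)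
    positivity
  refine ⟨_, hpos, ?_⟩
  rw [det_diffMap_eq_matrix_det, hF, hG]
  simp only [ContinuousLinearMap.comp_apply, add_apply, smul_apply, hgu, hsu]
  rw [hmat, det_four_columns, hmat2, det_stereo b hn hb1 v (by
    intro j; fin_cases j
    · exact hxT _
    · exact hxT _
    · exact hxS _
    · exact hxS _)]
  have := det_change_of_basis (f p : E5) T S A
  simp only [ContinuousLinearEquiv.coe_coe] at this
  rw [show (Matrix.vecCons (f p : E5) v : Fin 5 → E5) = ![(f p : E5), T (A (planeVec 0)),
    T (A (planeVec 1)), S (A (planeVec 0)), S (A (planeVec 1))] from rfl, this]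
  change _ = _ * (_ * Matrix.det (Matrix.of fun i j : Fin 5 => (![(f p : E5), T (planeVec 0),
    T (planeVec 1), S (planeVec 0), S (planeVec 1)] : Fin 5 → E5) i j))
  ring

/-- The signed number of zeros of a transverse normal section of a closed oriented surface in
the four-sphere vanishes. -/
theorem sum_zeroSign_eq_zero [CompactSpace M] [T2Space M] [IsManifold (𝓡 2) ∞ M]
    (o : SurfaceOrientation M) (hf : ContMDiff (𝓡 2) 𝓘(ℝ, E5) ∞ (fun q => (f q : E5)))
    (hi : ∀ p, Function.Injective (ambientDeriv (fun q => (f q : E5)) p))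
    (hinj : Function.Injective f) {s : M → E5} (hs : IsTransverseNormalSection f s)
    {Z : Finset M} (hZ : ∀ p, p ∈ Z ↔ s p = 0) : ∑ p ∈ Z, zeroSign f s p = 0 := by
  obtain ⟨v, hv, hfv⟩ := exists_unit_notMem_range hf
  obtain ⟨b, rfl⟩ := exists_orthonormalBasis_zero_eq hv
  obtain ⟨δ₁, hδ₁, hclose⟩ := exists_pos_eq_of_orthogonal hf hi
    (Subtype.val_injective.comp hinj)
  obtain ⟨δ₂, hδ₂, hfar⟩ := (isCompact_univ (X := M)).exists_forall_le'
    (f := fun q => ‖(f q : E5) - b 0‖) (a := 0) (hf.continuous.sub continuous_const).norm.continuousOn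
    (fun q _ => norm_pos_iff.2 (sub_ne_zero.2 (hfv q)))
  obtain ⟨C, hC⟩ := (isCompact_univ (X := M)).exists_bound_of_continuousOn
    hs.smooth.continuous.continuousOn
  -- Closeness δ₁ forces coincidences onto the diagonal, and δ₂ keeps the push-off away from the
  -- pole b₀. In the choice of ε, |C| + 1 keeps the denominator positive whatever the bound C is.
  set δ := min δ₁ δ₂ with hδ
  have hδ0 : 0 < δ := lt_min hδ₁ hδ₂
  set ε := δ / (2 * (|C| + 1)) with hε
  have hε0 : 0 < ε := by positivity
  have hεs : ∀ q, 2 * ‖ε • s q‖ < δ := by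
    intro q
    have h1 : ‖s q‖ < |C| + 1 := ((hC q (mem_univ q)).trans (le_abs_self C)).trans_lt (lt_add_one _)
    rw [norm_smul, Real.norm_eq_abs, abs_of_pos hε0]
    calc 2 * (ε * ‖s q‖) < 2 * (ε * (|C| + 1)) := by gcongr
      _ = δ := by rw [hε]; field_simp
  have hn : ∀ q, ‖(f q : E5)‖ = 1 := fun q => by simp
  have horth : ∀ q, inner ℝ (f q : E5) (s q) = (0 : ℝ) := fun q =>
    (mem_normalSpace_iff.1 (hs.normal q)).1
  have horth' : ∀ q, inner ℝ (f q : E5) (ε • s q) = (0 : ℝ) := fun q => by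
    rw [inner_smul_right, horth, mul_zero]
  set y : M → E5 := fun q => f q + ε • s q with hy
  have hy1 : ∀ q, 1 ≤ ‖y q‖ := fun q => (norm_normalize_add_sub_le (hn q) (horth' q)).1
  have hyδ : ∀ q, ‖‖y q‖⁻¹ • y q - f q‖ < δ := fun q =>
    (norm_normalize_add_sub_le (hn q) (horth' q)).2.trans_lt (hεs q)
  have hy0 : ∀ q, 0 < ‖y q‖ := fun q => one_pos.trans_le (hy1 q)
  have hyn : ∀ q, ‖‖y q‖⁻¹ • y q‖ = 1 := fun q => by
    rw [norm_smul, norm_inv, norm_norm, inv_mul_cancel₀ (hy0 q).ne']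
  have hyb : ∀ q, ‖y q‖⁻¹ • y q ≠ b 0 := by
    intro q h
    have h1 := hyδ q
    rw [h, norm_sub_rev] at h1
    exact (h1.trans_le (min_le_right _ _)).not_ge (hfar q (mem_univ q))
  have hyb1 : ∀ q, inner ℝ (b 0) (‖y q‖⁻¹ • y q) ≠ (1 : ℝ) := fun q =>
    inner_lt_norm_of_ne b (hyn q) (hyb q)
  have hfb1 : ∀ q, inner ℝ (b 0) (f q : E5) ≠ (1 : ℝ) := fun q =>
    inner_lt_norm_of_ne b (hn q) (hfv q)
  have hsmF : ContMDiff (𝓡 2) 𝓘(ℝ, FourSpace) ∞ (fun q => rayStereo b (f q)) := fun q =>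
    (contDiffAt_rayStereo b (norm_ne_zero_iff.1 (by rw [hn]; exact one_ne_zero))
      (by rw [hn]; exact hfb1 q)).contMDiffAt.comp q hf.contMDiffAt
  have hεsm : ContMDiff (𝓡 2) 𝓘(ℝ, E5) ∞ (fun q => ε • s q) :=
    (contDiff_const_smul ε).contMDiff.comp hs.smooth
  have hys : ContMDiff (𝓡 2) 𝓘(ℝ, E5) ∞ y := hf.add hεsm
  have hsmG : ContMDiff (𝓡 2) 𝓘(ℝ, FourSpace) ∞ (fun q => rayStereo b (y q)) := fun q =>
    (contDiffAt_rayStereo b (norm_pos_iff.1 (hy0 q)) (by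
      intro h
      apply hyb1 q
      rw [inner_smul_right, h, inv_mul_cancel₀ (hy0 q).ne'])).contMDiffAt.comp q hys.contMDiffAt
  have hcoin : ∀ p q, rayStereo b (f p) = rayStereo b (y q) → p = q ∧ p ∈ Z := by
    intro p q h
    rw [← rayStereo_smul b (inv_pos.2 (hy0 q)) (y q)] at h
    have hpq := rayStereo_injective_of_norm_one b (hn p) (hyn q) (hfb1 p) (hyb1 q) h
    have heq : p = q := by
      -- Here f p is a multiple of f q + ε s q, so f p - f q is a combination of f q and s q, both
      -- orthogonal to the tangent plane at q.
      refine hclose p q ?_ fun u => ?_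
      · rw [hpq]; exact (hyδ q).trans_le (min_le_left _ _)
      · have h1 := inner_ambientDeriv_eq_zero hf q u
        have h2 := (mem_normalSpace_iff.1 (hs.normal q)).2 u
        rw [real_inner_comm] at h2
        rw [hpq, hy]
        simp only [inner_sub_left, inner_smul_left, inner_add_left, h1, h2]
        simp
    subst heq
    refine ⟨rfl, (hZ p).2 ?_⟩
    -- Pairing f p = y p / ‖y p‖ with s p leaves ε ‖s p‖² / ‖y p‖ = 0.
    have h1 := horth p
    rw [hpq, hy] at h1
    simp only [inner_smul_left, inner_add_left, horth p, real_inner_self_eq_norm_sq] at h1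
    have h2 : (f p : E5) + ε • s p ≠ 0 := norm_pos_iff.1 (hy0 p)
    simpa [hε0.ne', h2] using h1
  choose c hc hcx using o.cover
  have hD := fun p (hp : p ∈ Z) => det_diffMap_rayStereo hf hs b (hfv p) ((hZ p).1 hp)
    (o.smooth (hc p)) (hcx p) ε
  set κ := Matrix.det (Matrix.of fun i j : Fin 5 => b j i) with hκ
  have hκ0 : κ ≠ 0 := det_orthonormalBasis_ne_zero b
  set W : M → ℝ := fun p => Matrix.det (Matrix.of fun i j : Fin 5 => (![(f p : E5),
      ambientDeriv (fun q => (f q : E5)) p (planeVec 0),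
      ambientDeriv (fun q => (f q : E5)) p (planeVec 1),
      ambientDeriv s p (planeVec 0), ambientDeriv s p (planeVec 1)] : Fin 5 → E5) i j) with hW
  have hW0 : ∀ p ∈ Z, W p ≠ 0 := fun p hp => hs.det_ne_zero hf hi ((hZ p).1 hp)
  have hsign : ∀ p ∈ Z, SignType.sign ((diffMap
      (fderiv ℝ ((fun q => rayStereo b (f q)) ∘ (c p).symm) (c p p))
      (fderiv ℝ ((fun q => rayStereo b (y q)) ∘ (c p).symm) (c p p))).det) =
      SignType.sign (-κ) * SignType.sign (W p) := by
    intro p hp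
    obtain ⟨r, hr, hdet⟩ := hD p hp
    rw [hdet, sign_mul, sign_pos (by positivity : 0 < ε ^ 2 * r), one_mul, sign_mul]
  have hmain := sum_sign_det_diffMap_eq_zero o hc hcx hsmF hsmG hcoin
    (fun p hp => by simp [hy, (hZ p).1 hp]) (fun p _ => rfl) (fun p hp h0 => by
      have := hsign p hp
      rw [h0, sign_zero, ← sign_mul, eq_comm, sign_eq_zero_iff] at this
      exact mul_ne_zero (neg_ne_zero.2 hκ0) (hW0 p hp) this)
  rw [Finset.sum_congr rfl fun p hp => by rw [hsign p hp, SignType.coe_mul],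
    ← Finset.mul_sum] at hmain
  have hk : (SignType.sign (-κ) : ℤ) ≠ 0 := by
    rcases lt_or_gt_of_ne (neg_ne_zero.2 hκ0) with h | h
    · simp [sign_neg h]
    · simp [sign_pos h]
  exact (mul_eq_zero.1 hmain).resolve_left hk

end EulerNumber

/-! ### Existence of a transverse section -/

/-- Finitely many differentiable maps of a finite-dimensional space to itself have a common
regular value. -/
theorem exists_common_regular_value {ι E : Type*} [NormedAddCommGroup E] [NormedSpace ℝ E]
    [FiniteDimensional ℝ E] (t : Finset ι) (ψ : ι → E → E) (ψ' : ι → E → E →L[ℝ] E)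
    (U : ι → Set E) (h : ∀ i ∈ t, ∀ x ∈ U i, HasFDerivAt (ψ i) (ψ' i x) x) :
    ∃ v, ∀ i ∈ t, ∀ x ∈ U i, ψ i x = v → (ψ' i x).det ≠ 0 := by
  borelize E
  set μ : Measure E := Measure.addHaar
  have hnull : μ (⋃ i ∈ t, ψ i '' {x ∈ U i | (ψ' i x).det = 0}) = 0 := by
    refine (measure_biUnion_null_iff t.countable_toSet).2 fun i hi => ?_
    exact addHaar_image_eq_zero_of_det_fderivWithin_eq_zero μ
      (fun x hx => (h i hi x hx.1).hasFDerivWithinAt) (fun x hx => hx.2)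
  have hne : (⋃ i ∈ t, ψ i '' {x ∈ U i | (ψ' i x).det = 0}) ≠ univ := by
    intro h1
    rw [h1] at hnull
    exact NeZero.ne μ (Measure.measure_univ_eq_zero.1 hnull)
  obtain ⟨v, hv⟩ := (ne_univ_iff_exists_notMem _).1 hne
  refine ⟨v, fun i hi x hx hxv h0 => hv ?_⟩
  simp only [mem_iUnion]
  exact ⟨i, hi, x, ⟨hx, h0⟩, hxv⟩

/-- The inner product of Euclidean five-space as a bilinear map. -/
noncomputable def innerBilin : E5 →L[ℝ] E5 →L[ℝ] ℝ :=
  ∑ k : Fin 5, (EuclideanSpace.proj k : E5 →L[ℝ] ℝ).smulRight (EuclideanSpace.proj k : E5 →L[ℝ] ℝ)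

theorem innerBilin_apply (x y : E5) : innerBilin x y = inner ℝ x y := by
  rw [PiLp.inner_apply]
  simp [innerBilin, sum_apply, mul_comm]

/-- The map `v ↦ ⟪v, A ·⟫`. -/
noncomputable def pairing (A : ℝ × Plane →L[ℝ] E5) : E5 →L[ℝ] (ℝ × Plane →L[ℝ] ℝ) :=
  ((ContinuousLinearMap.compL ℝ (ℝ × Plane) E5 ℝ).flip A).comp innerBilin

theorem pairing_apply (A : ℝ × Plane →L[ℝ] E5) (v : E5) (w : ℝ × Plane) :
    pairing A v w = inner ℝ v (A w) := by
  simp [pairing, innerBilin_apply]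

theorem contDiff_pairing : ContDiff ℝ ∞ pairing := by
  have h : ContDiff ℝ ∞ fun A : ℝ × Plane →L[ℝ] E5 =>
      (ContinuousLinearMap.compL ℝ (ℝ × Plane) E5 ℝ).flip A := ContinuousLinearMap.contDiff _
  exact h.clm_comp contDiff_const

/-- This is the Gram operator AᵀA: if AᵀA y = 0, then pairing with y gives ‖A y‖² = 0. -/
theorem isInvertible_pairing_comp {A : ℝ × Plane →L[ℝ] E5} (hA : Function.Injective A) :
    ((pairing A).comp A).IsInvertible := by
  have hinj : Function.Injective ((pairing A).comp A) := by
    rw [injective_iff_map_eq_zero]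
    intro y hy
    have h1 := congrArg (fun l : ℝ × Plane →L[ℝ] ℝ => l y) hy
    simp only [ContinuousLinearMap.comp_apply, pairing_apply, zero_apply,
      inner_self_eq_zero] at h1
    exact hA (h1.trans (map_zero A).symm)
  have hfr : Module.finrank ℝ (ℝ × Plane) = Module.finrank ℝ (ℝ × Plane →L[ℝ] ℝ) := by
    rw [← (LinearMap.toContinuousLinearMap (𝕜 := ℝ) (E := ℝ × Plane) (F' := ℝ)).finrank_eq]
    exact Subspace.dual_finrank_eq.symm
  exact ⟨(LinearEquiv.ofInjectiveOfFinrankEq ((pairing A).comp A : ℝ × Plane →ₗ[ℝ] _) hinj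
    hfr).toContinuousLinearEquiv, rfl⟩

/-- The coefficients of the orthogonal projection to the range of `A`. -/
noncomputable def projCoeff (A : ℝ × Plane →L[ℝ] E5) (v : E5) : ℝ × Plane :=
  ((pairing A).comp A).inverse (pairing A v)

/-- The normal equations of least squares: the projection is v - A(AᵀA)⁻¹Aᵀv. This explicit formula
shows smooth dependence on the base point, as operator inversion is smooth. -/
theorem starProjection_orthogonal_range {A : ℝ × Plane →L[ℝ] E5} (hA : Function.Injective A)
    (v : E5) : (A.range)ᗮ.starProjection v = v - A (projCoeff A v) := by
  have h1 : pairing A (A (projCoeff A v)) = pairing A v :=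
    (isInvertible_pairing_comp hA).self_apply_inverse (pairing A v)
  apply Submodule.eq_starProjection_of_mem_of_inner_eq_zero
  · rw [Submodule.mem_orthogonal]
    rintro _ ⟨w, rfl⟩
    have h2 := congrArg (fun l : ℝ × Plane →L[ℝ] ℝ => l w) h1
    simp only [pairing_apply] at h2
    change inner ℝ (A w) _ = (0 : ℝ)
    rw [real_inner_comm, inner_sub_left, h2, sub_self]
  · intro n hn
    rw [sub_sub_cancel]
    exact (Submodule.mem_orthogonal _ _).1 hn _ ⟨_, rfl⟩

theorem contDiffAt_projCoeff {B : Plane → ℝ × Plane →L[ℝ] E5} {z : Plane}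
    (hB : ContDiffAt ℝ ∞ B z) (hi : Function.Injective (B z)) (v : E5) :
    ContDiffAt ℝ ∞ (fun y => projCoeff (B y) v) z := by
  have hp : ContDiffAt ℝ ∞ (fun y => pairing (B y)) z := contDiff_pairing.contDiffAt.comp z hB
  have h1 := (isInvertible_pairing_comp hi).contDiffAt_map_inverse (n := ∞)
  exact (h1.comp z (hp.clm_comp hB)).clm_apply (hp.clm_apply contDiffAt_const)

section Existence

variable {M : Type*} [TopologicalSpace M] [ChartedSpace Plane M] {f : M → S4}

/-- The frame `(λ, w) ↦ λ h(z) + Dh(z) w` of the span of the position vector and the tangent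
plane of a parametrized surface. -/
noncomputable def tangentFrame (h : Plane → E5) (z : Plane) : ℝ × Plane →L[ℝ] E5 :=
  (ContinuousLinearMap.fst ℝ ℝ Plane).smulRight (h z) +
    (fderiv ℝ h z).comp (ContinuousLinearMap.snd ℝ ℝ Plane)

theorem tangentFrame_apply (h : Plane → E5) (z : Plane) (y : ℝ × Plane) :
    tangentFrame h z y = y.1 • h z + fderiv ℝ h z y.2 := rfl

theorem contDiffAt_tangentFrame {h : Plane → E5} {z : Plane} (hh : ContDiffAt ℝ ∞ h z) :
    ContDiffAt ℝ ∞ (tangentFrame h) z :=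
  (contDiffAt_const.smulRight hh).add
    ((hh.fderiv_right (m := ∞) (by simp)).clm_comp contDiffAt_const)

theorem range_tangentFrame_orthogonal [IsManifold (𝓡 2) ∞ M]
    (hf : ContMDiff (𝓡 2) 𝓘(ℝ, E5) ∞ (fun q => (f q : E5)))
    {c : OpenPartialHomeomorph M Plane} (hc : c ∈ IsManifold.maximalAtlas (𝓡 2) ∞ M) {p : M}
    (hp : p ∈ c.source) :
    (tangentFrame ((fun q => (f q : E5)) ∘ c.symm) (c p)).rangeᗮ = normalSpace f p := by
  rw [normalSpace, ← range_fderiv_comp_chart_symm hc hp hf]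
  congr 1
  have h1 : ((fun q => (f q : E5)) ∘ c.symm) (c p) = f p := by simp [c.left_inv hp]
  ext y
  rw [Submodule.mem_sup]
  constructor
  · rintro ⟨w, rfl⟩
    refine ⟨w.1 • (f p : E5), Submodule.smul_mem _ _ (Submodule.mem_span_singleton_self _),
      _, ⟨w.2, rfl⟩, ?_⟩
    rw [← h1]; rfl
  · rintro ⟨a, ha, _, ⟨w, rfl⟩, rfl⟩
    obtain ⟨r, rfl⟩ := Submodule.mem_span_singleton.1 ha
    refine ⟨(r, w), ?_⟩
    rw [← h1]; rfl

theorem injective_tangentFrame [IsManifold (𝓡 2) ∞ M]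
    (hf : ContMDiff (𝓡 2) 𝓘(ℝ, E5) ∞ (fun q => (f q : E5)))
    (hi : ∀ p, Function.Injective (ambientDeriv (fun q => (f q : E5)) p))
    {c : OpenPartialHomeomorph M Plane} (hc : c ∈ IsManifold.maximalAtlas (𝓡 2) ∞ M) {p : M}
    (hp : p ∈ c.source) :
    Function.Injective (tangentFrame ((fun q => (f q : E5)) ∘ c.symm) (c p)) := by
  rw [injective_iff_map_eq_zero]
  rintro ⟨r, w⟩ h
  rw [tangentFrame_apply] at h
  obtain ⟨A, hA⟩ := exists_equiv_fderiv_comp_chart_symm hc hp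
  have h1 : ((fun q => (f q : E5)) ∘ c.symm) (c p) = f p := by simp [c.left_inv hp]
  rw [h1] at h
  have h2 := congrArg (fun y => inner ℝ (f p : E5) y) h
  simp only [inner_add_right, inner_smul_right, hA _ hf,
    real_inner_self_eq_norm_sq, inner_zero_right] at h2
  have h3 := inner_ambientDeriv_eq_zero hf p (A w)
  have hr : r = 0 := by simpa [h3] using h2
  have hw : w = 0 := by
    apply injective_fderiv_comp_chart_symm hc hp hf (hi p)
    simpa [hr] using h
  rw [hr, hw]; rfl

/-- Projecting a generic constant vector to the normal spaces gives a transverse section. -/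
theorem exists_isTransverseNormalSection [CompactSpace M] [IsManifold (𝓡 2) ∞ M]
    (hf : ContMDiff (𝓡 2) 𝓘(ℝ, E5) ∞ (fun q => (f q : E5)))
    (hi : ∀ p, Function.Injective (ambientDeriv (fun q => (f q : E5)) p)) :
    ∃ s : M → E5, IsTransverseNormalSection f s := by
  obtain ⟨t, ht⟩ := exists_finset_chart_cover (M := M)
  have hm : ∀ x : M, chartAt Plane x ∈ IsManifold.maximalAtlas (𝓡 2) ∞ M := fun x =>
    IsManifold.chart_mem_maximalAtlas x
  set B : M → Plane → ℝ × Plane →L[ℝ] E5 := fun x =>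
    tangentFrame ((fun q => (f q : E5)) ∘ (chartAt Plane x).symm) with hB
  have hBs : ∀ x, ∀ z ∈ (chartAt Plane x).target, ContDiffAt ℝ ∞ (B x) z := fun x z hz =>
    contDiffAt_tangentFrame (contDiffAt_comp_chart_symm (hm x) hf hz)
  have hBi : ∀ x, ∀ p ∈ (chartAt Plane x).source, Function.Injective (B x (chartAt Plane x p)) :=
    fun x p hp => injective_tangentFrame hf hi (hm x) hp
  have hBd : ∀ x, ∀ z ∈ (chartAt Plane x).target, HasFDerivAt (B x) (fderiv ℝ (B x) z) z :=
    fun x z hz => ((hBs x z hz).differentiableAt (by simp)).hasFDerivAt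
  -- Frame coefficients over the surface form a space of dimension 2 + 3 = 5. Identifying it with
  -- the target E5 allows the equal-dimensional Sard theorem.
  obtain e : E5 ≃L[ℝ] Plane × (ℝ × Plane) := ContinuousLinearEquiv.ofFinrankEq (by simp)
  set Ψ : M → Plane × (ℝ × Plane) → Plane × (ℝ × Plane) →L[ℝ] E5 := fun x v =>
    (B x v.1).comp (ContinuousLinearMap.snd ℝ Plane (ℝ × Plane)) +
      ((fderiv ℝ (B x) v.1).comp (ContinuousLinearMap.fst ℝ Plane (ℝ × Plane))).flip v.2 with hΨ
  have hΨd : ∀ x, ∀ v : Plane × (ℝ × Plane), v.1 ∈ (chartAt Plane x).target →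
      HasFDerivAt (fun v : Plane × (ℝ × Plane) => B x v.1 v.2) (Ψ x v) v := fun x v hv =>
    ((hBd x v.1 hv).comp v hasFDerivAt_fst).clm_apply hasFDerivAt_snd
  obtain ⟨v', hv'⟩ := exists_common_regular_value t
    (fun x v => e (B x v.1 v.2)) (fun x v => (e : E5 →L[ℝ] Plane × (ℝ × Plane)).comp (Ψ x v))
    (fun x => {v | v.1 ∈ (chartAt Plane x).target})
    (fun x _ v hv => e.hasFDerivAt.comp v (hΨd x v hv))
  set v : E5 := e.symm v' with hv
  set s : M → E5 := fun p => (normalSpace f p).starProjection v with hs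
  have hloc : ∀ x, ∀ p ∈ (chartAt Plane x).source, s p =
      v - B x (chartAt Plane x p) (projCoeff (B x (chartAt Plane x p)) v) := by
    intro x p hp
    rw [← starProjection_orthogonal_range (hBi x p hp)]
    simp only [hs, ← range_tangentFrame_orthogonal hf (hm x) hp, hB]
  set Y : M → Plane → ℝ × Plane := fun x z => projCoeff (B x z) v with hY
  have hYs : ∀ x, ∀ z ∈ (chartAt Plane x).target, ContDiffAt ℝ ∞ (Y x) z := by
    intro x z hz
    have h1 := hBi x _ ((chartAt Plane x).map_target hz)
    rw [(chartAt Plane x).right_inv hz] at h1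
    exact contDiffAt_projCoeff (hBs x z hz) h1 v
  have hsmooth : ContMDiff (𝓡 2) 𝓘(ℝ, E5) ∞ s := by
    intro p
    have hp := mem_chart_source Plane p
    have h1 : ContDiffAt ℝ ∞ (fun z => v - B p z (Y p z)) (chartAt Plane p p) :=
      contDiffAt_const.sub ((hBs p _ ((chartAt Plane p).map_source hp)).clm_apply
        (hYs p _ ((chartAt Plane p).map_source hp)))
    refine (h1.contMDiffAt.comp p (contMDiffAt_of_mem_maximalAtlas (hm p) hp)).congr_of_eventuallyEq
      ?_
    filter_upwards [(chartAt Plane p).open_source.mem_nhds hp] with q hq using hloc p q hq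
  refine ⟨s, hsmooth, fun p => Submodule.starProjection_apply_mem _ _, fun p hp0 => ?_⟩
  obtain ⟨x, hxt, hpx⟩ := ht p
  set c := chartAt Plane x with hc
  set z := c p with hz
  have hzt : z ∈ c.target := c.map_source hpx
  rw [← range_fderiv_comp_chart_symm (hm x) hpx hsmooth,
    ← range_tangentFrame_orthogonal hf (hm x) hpx]
  change (fderiv ℝ (s ∘ c.symm) z).range = (B x z).rangeᗮ
  have hSeq : s ∘ c.symm =ᶠ[𝓝 z] fun y => v - B x y (Y x y) := by
    filter_upwards [c.open_target.mem_nhds hzt] with y hy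
    have := hloc x (c.symm y) (c.map_target hy)
    rw [c.right_inv hy] at this
    exact this
  -- At a zero of s the vector v lies in the span of the frame, so (z, Y z) is a preimage of the
  -- regular value v.
  have hvz : B x z (Y x z) = v := by
    have := hloc x p hpx
    rw [hp0, eq_comm, sub_eq_zero] at this
    exact this.symm
  have hYd := ((hYs x z hzt).differentiableAt (by simp)).hasFDerivAt
  have hSd : HasFDerivAt (s ∘ c.symm) (fderiv ℝ (s ∘ c.symm) z) z :=
    ((contDiffAt_comp_chart_symm (hm x) hsmooth hzt).differentiableAt (by simp)).hasFDerivAt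
  have hS : ∀ u, fderiv ℝ (s ∘ c.symm) z u =
      -(B x z (fderiv ℝ (Y x) z u) + fderiv ℝ (B x) z u (Y x z)) := by
    intro u
    rw [hSeq.fderiv_eq, (((hBd x z hzt).clm_apply hYd).const_sub v).fderiv]
    simp
  -- Differentiate ⟨B(y) w, s⟩ = 0; the term with the derivative of B drops out because s vanishes
  -- at the point.
  have hnormal : ∀ u, fderiv ℝ (s ∘ c.symm) z u ∈ (B x z).rangeᗮ := by
    intro u
    rw [Submodule.mem_orthogonal]
    rintro _ ⟨w, rfl⟩
    have h1 := ((hBd x z hzt).clm_apply (hasFDerivAt_const w z)).inner ℝ hSd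
    have h2 : (fun y => inner ℝ (B x y w) ((s ∘ c.symm) y)) =ᶠ[𝓝 z] fun _ => (0 : ℝ) := by
      filter_upwards [c.open_target.mem_nhds hzt] with y hy
      have h3 : s (c.symm y) ∈ normalSpace f (c.symm y) := Submodule.starProjection_apply_mem _ _
      rw [← range_tangentFrame_orthogonal hf (hm x) (c.map_target hy), ← hc, c.right_inv hy] at h3
      exact (Submodule.mem_orthogonal _ _).1 h3 _ ⟨w, rfl⟩
    have h4 := h1.unique ((hasFDerivAt_const (0 : ℝ) z).congr_of_eventuallyEq h2)
    have h5 := congrArg (fun l : Plane →L[ℝ] ℝ => l u) h4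
    have h6 : s (c.symm z) = 0 := by simp [hz, c.left_inv hpx, hp0]
    simpa [h6, fderivInnerCLM_apply] using h5
  have hdet := hv' x hxt (z, Y x z) hzt (by simp [hvz, hv])
  have hsurj : Function.Surjective (Ψ x (z, Y x z)) := by
    intro n
    obtain ⟨w, hw⟩ := (ContinuousLinearMap.toContinuousLinearEquivOfDetNeZero _ hdet).surjective
      (e n)
    refine ⟨w, e.injective ?_⟩
    rw [← hw]
    rfl
  apply le_antisymm
  · rintro _ ⟨u, rfl⟩
    exact hnormal u
  · intro n hn
    obtain ⟨⟨u, w⟩, huw⟩ := hsurj n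
    have huw' : B x z w + fderiv ℝ (B x) z u (Y x z) = n := by
      rw [← huw]; simp [hΨ]
    -- Modulo the range of B, ds(-u) equals (DB u)(Y), and so does n. Their difference is both in
    -- the range of B and orthogonal to it, hence zero.
    refine ⟨-u, ?_⟩
    have hrange : n - fderiv ℝ (s ∘ c.symm) z (-u) ∈ (B x z).range := by
      refine ⟨w - fderiv ℝ (Y x) z u, ?_⟩
      change B x z (w - fderiv ℝ (Y x) z u) = _
      rw [hS, ← huw', map_sub, map_neg, map_neg, map_neg]
      simp only [neg_apply]
      abel
    have hperp : n - fderiv ℝ (s ∘ c.symm) z (-u) ∈ (B x z).rangeᗮ :=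
      Submodule.sub_mem _ hn (hnormal _)
    have h0 := (Submodule.mem_orthogonal _ _).1 hperp _ hrange
    rw [inner_self_eq_zero, sub_eq_zero] at h0
    exact h0.symm

end Existence

/-! ### The normal Euler number of an oriented surface -/

theorem mainTheorem6 {M : Type*} [TopologicalSpace M] [CompactSpace M]
    [ChartedSpace (EuclideanSpace ℝ (Fin 2)) M] [IsManifold (𝓡 2) ∞ M]
    (o : SurfaceOrientation M) (f : M → S4)
    (hf : Manifold.IsSmoothEmbedding (𝓡 2) (𝓡 4) ∞ f) :
    IsNormalEulerNumber f 0 := by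
  have : T2Space M := hf.isEmbedding.t2Space
  have hs := contMDiff_coe_comp hf
  have hi := injective_ambientDeriv hf
  refine ⟨exists_isTransverseNormalSection hs hi, fun s h => ⟨h.finite_zeros, ?_⟩⟩
  rw [finsum_mem_eq_finite_toFinset_sum _ h.finite_zeros]
  exact sum_zeroSign_eq_zero o hs hi hf.isEmbedding.injective h fun p => by simp
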